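/- \textbf{The Herlihy--Wing queue.} Shared memory consists of an unbounded array $Q[1],Q[2],\dots$, all entries initially $\bot$, and a variable $X$, initially $1$. Values are natural numbers. The object has two methods; each labelled line is one atomic step. $enq(v)$: $E_1$: $i := getAndInc(X)$ (atomically read $X$ and increase it by $1$); $E_2$: $Q[i] := v$; $E_3$: return $ack$. $deq()$: $D_1$: $l := X$; $D_2$: if $l=1$ go to $D_1$, else $j:=1$; $D_3$: $x := swap(Q[j],\bot)$ (atomically set $Q[j]$ to $\bot$ and $x$ to its old value); if $x\neq\bot$ go to $D_4$; otherwise, if $j=l-1$ go to $D_1$, else $j:=j+1$ and go to $D_3$; $D_4$: return $x$. In the concurrent system with $n$ processes $P_1,\dots,P_n$, the processes interleave their atomic steps, and each of them repeatedly calls an arbitrary method with an arbitrary argument. The history $h$ of a finite trace is the projection of the trace to its call and return actions. \textbf{The specification.} $Queue$ is the set of all finite sequences of operations that can be executed, starting from the empty queue, by the sequential FIFO queue with operations $enq(v)\Rightarrow ack$ (appends $v$), $deq()\Rightarrow v$ (if $v$ is the oldest element; removes it), and $deq()\Rightarrow empty$ (only if the queue is empty; changes nothing). \textbf{Linearizability.}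 A history is a finite sequence of call and return actions in which the actions of each process alternate between calls and matching returns, starting with a call. A history $h$ is linearizable w.r.t. $Queue$ if there are a history $h'$ obtained from $h$ by appending zero or more return actions, and a sequential history $s = call\cdot return\cdots call\cdot return$ of the $n$ processes whose sequence of operations is in $Queue$, such that (i) $complete(h')$, the subsequence of all matched call and return actions of $h'$, has the same subsequence of actions as $s$ for every process, and (ii) for all operations $o_1,o_2$ of $complete(h')$, if the return of $o_1$ occurs before the call of $o_2$ in $h$, then the same holds in $s$. \textbf{Corollary.} For every $n$, the Herlihy--Wing queue is linearizable w.r.t. $Queue$ for $n$ processes: the history of every finite trace of the system with $n$ processes is linearizable w.r.t. $Queue$. -/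

import Mathlib

namespace HWQ

/-! ## Labelled transition systems and their finite traces -/

/-- A labelled transition system with transition labels in `L`. -/
structure LTS (L : Type) where
  /-- states (configurations) -/
  State : Type
  /-- the initial state -/
  init : State
  /-- the transition relation -/
  Tr : State → L → State → Prop

namespace LTS

variable {L : Type}

/-- `A.Path q t q'`: there is a finite path of `A` from `q` to `q'` whose sequence of labels
is `t`. -/
inductive Path (A : LTS L) : A.State → List L → A.State → Prop
  | nil (q : A.State) : Path A q [] q
  | cons {q q' q'' : A.State} {b : L} {t : List L} :
      A.Tr q b q' → Path A q' t q'' → Path A q (b :: t) q''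

/-- The finite traces of `A`: label sequences of finite paths that start in the initial state. -/
def traces (A : LTS L) : Set (List L) := {t | ∃ q, A.Path A.init t q}

theorem Path.of_append {A : LTS L} {q q' : A.State} {t u : List L} (h : A.Path q (t ++ u) q') :
    ∃ r, A.Path q t r := by
  induction t generalizing q with
  | nil => exact ⟨q, Path.nil q⟩
  | cons b t ih =>
    cases h with
    | cons h1 h2 =>
      obtain ⟨r, hr⟩ := ih h2
      exact ⟨r, Path.cons h1 hr⟩

theorem traces_prefix_closed (A : LTS L) {t u : List L} (h : t <+: u) (hu : u ∈ A.traces) :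
    t ∈ A.traces := by
  obtain ⟨v, rfl⟩ := h
  obtain ⟨q, hq⟩ := hu
  exact hq.of_append

end LTS

/-! ## Methods, operations, sequential specifications, actions, histories -/

/-- The interface of an object: its methods, and for each method the type of its argument and
the type of its return value. -/
structure Interface where
  Method : Type
  Arg : Method → Type
  Ret : Method → Type

/-- An operation `m(a) ⇒ b`. -/
structure Operation (S : Interface) where
  method : S.Method
  arg : S.Arg method
  ret : S.Ret method

/-- A sequential specification: a prefix-closed set of finite sequences of operations. -/
structure SeqSpec (S : Interface) where
  seqs : Set (List (Operation S))
  prefix_closed : ∀ {t u : List (Operation S)}, t <+: u → u ∈ seqs → t ∈ seqs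

/-- The sequential specification given by an LTS that is labelled by operations. -/
def SeqSpec.ofLTS {S : Interface} (A : LTS (Operation S)) : SeqSpec S where
  seqs := A.traces
  prefix_closed := A.traces_prefix_closed

/-- Call and return actions of the processes `Fin n`. -/
inductive Action (S : Interface) (n : ℕ) : Type
  | call (p : Fin n) (m : S.Method) (a : S.Arg m)
  | ret (p : Fin n) (m : S.Method) (b : S.Ret m)

namespace Action

variable {S : Interface} {n : ℕ}

/-- The process of an action. -/
def proc : Action S n → Fin n
  | call p _ _ => p
  | ret p _ _ => p

/-- The action is a call action. -/
def isCall : Action S n → Bool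
  | call _ _ _ => true
  | ret _ _ _ => false

/-- The action is a return action. -/
def isRet : Action S n → Bool
  | call _ _ _ => false
  | ret _ _ _ => true

end Action

section Histories

variable {S : Interface} {n : ℕ}

/-- The process subhistory `h|p`. -/
def subhistory (h : List (Action S n)) (p : Fin n) : List (Action S n) :=
  h.filter (fun e => decide (e.proc = p))

/-- Sequential sequences of actions: they alternate between call actions and matching return
actions (same process, same method), starting with a call; the last call may be pending. -/
inductive IsSequential : List (Action S n) → Prop
  | nil : IsSequential []
  | pending (p : Fin n) (m : S.Method) (a : S.Arg m) : IsSequential [Action.call p m a]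
  | cons (p : Fin n) (m : S.Method) (a : S.Arg m) (b : S.Ret m) {t : List (Action S n)} :
      IsSequential t → IsSequential (Action.call p m a :: Action.ret p m b :: t)

/-- A (well-formed) history: every process subhistory is sequential. -/
def IsHistory (h : List (Action S n)) : Prop := ∀ p, IsSequential (subhistory h p)

/-- Two histories are equivalent if they have the same process subhistories. -/
def Equivalent (h h' : List (Action S n)) : Prop := ∀ p, subhistory h p = subhistory h' p

/-- The action at position `i` of `h` is a call action, the one at position `j` is the follow-up
matching return action: same process, same method, no action of that process in between. -/
def Matches (h : List (Action S n)) (i j : ℕ) : Prop :=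
  i < j ∧ ∃ (p : Fin n) (m : S.Method) (a : S.Arg m) (b : S.Ret m),
    h[i]? = some (Action.call p m a) ∧ h[j]? = some (Action.ret p m b) ∧
    ∀ k, i < k → k < j → ∀ e, h[k]? = some e → e.proc ≠ p

open Classical in
/-- `complete h`: the subsequence of `h` of all call and return actions that are matched. -/
noncomputable def complete (h : List (Action S n)) : List (Action S n) :=
  ((List.finRange h.length).filter
    (fun i : Fin h.length => decide (∃ j : ℕ, Matches h (i : ℕ) j ∨ Matches h j (i : ℕ)))).map h.get

/-- Position `i` of `h` holds the call action of the operation `(p, k)`, which is the operation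
number `k` (counted from `0`) of process `p`. Equivalent histories have the same operations under
this naming. -/
def InvAt (h : List (Action S n)) (o : Fin n × ℕ) (i : ℕ) : Prop :=
  (∃ (m : S.Method) (a : S.Arg m), h[i]? = some (Action.call o.1 m a)) ∧
  (subhistory (h.take i) o.1).countP Action.isCall = o.2

/-- Position `j` of `h` holds the return action of the operation `o`. -/
def ResAt (h : List (Action S n)) (o : Fin n × ℕ) (j : ℕ) : Prop :=
  ∃ i, InvAt h o i ∧ Matches h i j

/-- The operation `o` has both its call action and its return action in `h`. -/
def IsCompleteOp (h : List (Action S n)) (o : Fin n × ℕ) : Prop := ∃ j, ResAt h o j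

/-- The happen-before relation `o₁ <_h o₂`: in `h`, the return action of `o₁` occurs before the
call action of `o₂`. -/
def HappensBefore (h : List (Action S n)) (o₁ o₂ : Fin n × ℕ) : Prop :=
  ∃ j i, ResAt h o₁ j ∧ InvAt h o₂ i ∧ j < i

/-- The sequential histories of `n` processes that correspond to a sequential specification. -/
def toHistory (Spec : SeqSpec S) (n : ℕ) : Set (List (Action S n)) :=
  {s | ∃ w : List (Fin n × Operation S), w.map Prod.snd ∈ Spec.seqs ∧
    s = w.flatMap (fun x =>
      [Action.call x.1 x.2.method x.2.arg, Action.ret x.1 x.2.method x.2.ret])}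

/-- Linearizability of a history: some extension `h'` of `h` by return actions is again a history,
`complete h'` is equivalent to a sequential history `s` of the specification, and `s` respects the
happen-before relation of `h` on the operations of `complete h'` (all operations that are complete
in `h`, and those pending in `h` that are completed in `h'`). -/
def LinearizableHistory (Spec : SeqSpec S) (h : List (Action S n)) : Prop :=
  ∃ r : List (Action S n), (∀ e ∈ r, e.isRet = true) ∧ IsHistory (h ++ r) ∧
    ∃ s ∈ toHistory Spec n,
      Equivalent (complete (h ++ r)) s ∧
      ∀ o₁ o₂ : Fin n × ℕ, IsCompleteOp (h ++ r) o₁ → IsCompleteOp (h ++ r) o₂ →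
        HappensBefore h o₁ o₂ → HappensBefore s o₁ o₂

end Histories

/-! ## Concurrent objects and their semantics under most general clients -/

/-- A concurrent object with interface `S`: a shared memory and, for each method, code that is run
by a process. `Local m` consists of the control states and registers of a process that executes
the method `m`. The first argument of `step` and `output` is the identity of the executing
process. -/
structure ConcObject (S : Interface) where
  Shared : Type
  init : Shared
  Local : S.Method → Type
  /-- state of the process immediately after the call with the given argument -/
  start : (m : S.Method) → S.Arg m → Local m
  /-- execution of one atomic command -/
  step : ℕ → (m : S.Method) → Shared → Local m → Shared → Local m → Prop
  /-- the process is about to return the given value -/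
  output : ℕ → (m : S.Method) → Local m → S.Ret m → Prop

/-- Transition labels: call and return actions, and internal actions of a process. -/
inductive Label (S : Interface) (n : ℕ) : Type
  | act (e : Action S n)
  | internal (p : Fin n)

/-- `history e`: the projection of a trace to its call and return actions. -/
def history {S : Interface} {n : ℕ} (t : List (Label S n)) : List (Action S n) :=
  t.filterMap (fun b => match b with
    | Label.act e => some e
    | Label.internal _ => none)

namespace ConcObject

variable {S : Interface}

/-- A configuration: the shared memory and, for each process, either `none` (no method is being
executed) or the executed method with the local state. -/
structure Config (O : ConcObject S) (n : ℕ) where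
  shared : O.Shared
  procs : Fin n → Option (Σ m : S.Method, O.Local m)

/-- The transitions of `n` processes that interact with `O`, each running a most general client:
a process that executes no method may call any method with any argument. -/
inductive Tr (O : ConcObject S) (n : ℕ) : O.Config n → Label S n → O.Config n → Prop
  | call (c : O.Config n) (p : Fin n) (m : S.Method) (a : S.Arg m) :
      c.procs p = none →
      Tr O n c (Label.act (Action.call p m a))
        ⟨c.shared, Function.update c.procs p (some ⟨m, O.start m a⟩)⟩
  | step (c : O.Config n) (p : Fin n) (m : S.Method) (l l' : O.Local m) (g : O.Shared) :
      c.procs p = some ⟨m, l⟩ → O.step p m c.shared l g l' →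
      Tr O n c (Label.internal p) ⟨g, Function.update c.procs p (some ⟨m, l'⟩)⟩
  | ret (c : O.Config n) (p : Fin n) (m : S.Method) (l : O.Local m) (b : S.Ret m) :
      c.procs p = some ⟨m, l⟩ → O.output p m l b →
      Tr O n c (Label.act (Action.ret p m b))
        ⟨c.shared, Function.update c.procs p none⟩

/-- The operational semantics of `O` with `n` processes. -/
def semantics (O : ConcObject S) (n : ℕ) : LTS (Label S n) where
  State := O.Config n
  init := ⟨O.init, fun _ => none⟩
  Tr := O.Tr n

/-- `O` is linearizable w.r.t. `Spec` for `n` processes. -/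
def Linearizable (O : ConcObject S) (Spec : SeqSpec S) (n : ℕ) : Prop :=
  ∀ t ∈ (O.semantics n).traces, LinearizableHistory Spec (history t)

end ConcObject

/-! ## The queue specification -/

/-- The methods of a queue. -/
inductive QMethod : Type
  | enq
  | deq

/-- The interface of a queue of natural numbers: `enq` takes a value and returns only an
acknowledgement; `deq` takes no argument and returns a value, or `none` to report an empty
queue. -/
abbrev queueInterface : Interface where
  Method := QMethod
  Arg := fun m => match m with
    | QMethod.enq => ℕ
    | QMethod.deq => Unit
  Ret := fun m => match m with
    | QMethod.enq => Unit
    | QMethod.deq => Option ℕ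

/-- The operation `enq(v) ⇒ ack`. -/
def enqOp (v : ℕ) : Operation queueInterface := ⟨QMethod.enq, v, ()⟩

/-- The operation `deq() ⇒ r`. -/
def deqOp (r : Option ℕ) : Operation queueInterface := ⟨QMethod.deq, (), r⟩

/-- The transitions of the sequential queue; the head of the list is the oldest value. -/
inductive QueueTr : List ℕ → Operation queueInterface → List ℕ → Prop
  | enq (q : List ℕ) (v : ℕ) : QueueTr q (enqOp v) (q ++ [v])
  | deq (q : List ℕ) (v : ℕ) : QueueTr (v :: q) (deqOp (some v)) q
  | deqEmpty : QueueTr [] (deqOp none) []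

/-- The sequential specification `Queue` (deterministic and non-blocking). -/
def queueSpec : SeqSpec queueInterface :=
  SeqSpec.ofLTS { State := List ℕ, init := [], Tr := QueueTr }

/-! ## The Herlihy–Wing queue -/

/-- Shared memory: the unbounded array `Q` (used from index `1` on; `none` is the value `⊥`) and the
variable `X`. -/
structure HWShared where
  Q : ℕ → Option ℕ
  X : ℕ

/-- Control states of `enq(v)`, with the registers that are still in use. The next line to be
executed is
`E1: i := getAndInc(X)`, `E2: Q[i] := v`, or `E3: return ack`. -/
inductive EnqState : Type
  | E1 (v : ℕ)
  | E2 (v i : ℕ)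
  | E3

/-- Control states of `deq()`, with the registers that are still in use. The next line to be
executed is
`D1: l := X`,
`D2: if l = 1 then go to D1, else j := 1`,
`D3: x := swap(Q[j], ⊥)`; if `x ≠ ⊥` then go to `D4`; otherwise, if `j = l - 1` then go to `D1`,
else `j := j + 1` and go to `D3`, or
`D4: return x`. -/
inductive DeqState : Type
  | D1
  | D2 (l : ℕ)
  | D3 (l j : ℕ)
  | D4 (x : ℕ)

/-- The atomic commands of `enq`. -/
inductive EnqStep : HWShared → EnqState → HWShared → EnqState → Prop
  | E1 (g : HWShared) (v : ℕ) :
      EnqStep g (EnqState.E1 v) { g with X := g.X + 1 } (EnqState.E2 v g.X)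
  | E2 (g : HWShared) (v i : ℕ) :
      EnqStep g (EnqState.E2 v i) { g with Q := Function.update g.Q i (some v) } EnqState.E3

/-- The atomic commands of `deq`. -/
inductive DeqStep : HWShared → DeqState → HWShared → DeqState → Prop
  | D1 (g : HWShared) : DeqStep g DeqState.D1 g (DeqState.D2 g.X)
  | D2_retry (g : HWShared) : DeqStep g (DeqState.D2 1) g DeqState.D1
  | D2_scan (g : HWShared) (l : ℕ) : l ≠ 1 → DeqStep g (DeqState.D2 l) g (DeqState.D3 l 1)
  | D3_take (g : HWShared) (l j x : ℕ) : g.Q j = some x →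
      DeqStep g (DeqState.D3 l j) { g with Q := Function.update g.Q j none } (DeqState.D4 x)
  | D3_retry (g : HWShared) (l j : ℕ) : g.Q j = none → j + 1 = l →
      DeqStep g (DeqState.D3 l j) g DeqState.D1
  | D3_next (g : HWShared) (l j : ℕ) : g.Q j = none → j + 1 ≠ l →
      DeqStep g (DeqState.D3 l j) g (DeqState.D3 l (j + 1))

/-- The Herlihy–Wing queue. Initially `X = 1` and every entry of `Q` is `⊥`. -/
def hwq : ConcObject queueInterface where
  Shared := HWShared
  init := { Q := fun _ => none, X := 1 }
  Local := fun m => match m with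
    | QMethod.enq => EnqState
    | QMethod.deq => DeqState
  start := fun m => match m with
    | QMethod.enq => fun v => EnqState.E1 v
    | QMethod.deq => fun _ => DeqState.D1
  step := fun _ m => match m with
    | QMethod.enq => EnqStep
    | QMethod.deq => DeqStep
  output := fun _ m => match m with
    | QMethod.enq => fun l b => l = EnqState.E3 ∧ b = ()
    | QMethod.deq => fun l b => ∃ x, l = DeqState.D4 x ∧ b = some x

end HWQ

/-! The order of two overlapping enqueues is fixed neither by the index obtained at `E1` nor by the
write at `E2`: it depends on how later scans run. The abstract queue is therefore not a function of
the past, and the proof is a backward simulation: for each step and each admissible abstract content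
after it, an admissible content before it is found from which the atomic queue can follow the step
(`Follows`).

Ghost variables name the enqueues in call order and record their indices, their real-time order
`hb`, and which are written, taken or returned. An admissible content (`Represents`) is any
duplicate-free list of untaken enqueues that includes all returned untaken ones and never
contradicts `hb`.

Two steps carry the argument. A successful swap is the point where a dequeue takes effect;
backwards, the removed enqueue `e` is put at the front (`follows_take`). This is admissible since an
untaken `y` with `hb y e` would have a smaller index, and the scan would have met its value there.
At a call of an enqueue, all entries behind the new one are pending, because the returned ones
precede it in real time; the content is cut there, and the removed tail takes effect right after the
call (`follows_callEnq`).

In the initial state only the empty content is admissible, so choosing contents backwards along a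
trace and then running forwards gives a run of an atomic queue with the same history (`exists_run`).
Such runs are linearizable for every specification given by a transition system
(`AtomicRun.linearizableHistory`). -/

namespace HWQ

/-! ### Atomic objects and the linearizability of their histories -/

section AtomicRuns

variable {S : Interface} {n : ℕ}

/-- The status of a process that uses an atomic object. -/
inductive Status (S : Interface) : Type
  | idle
  | called (m : S.Method) (a : S.Arg m)
  | done (o : Operation S)

/-- Runs of the atomic object with specification `A`: between the call and the return of an
operation, the operation takes effect atomically. The run has history `h`, and `w` lists the
operations in the order in which they take effect. -/
inductive AtomicRun (A : LTS (Operation S)) :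
    List (Action S n) → List (Fin n × Operation S) → (Fin n → Status S) → A.State → Prop
  | init : AtomicRun A [] [] (fun _ => Status.idle) A.init
  | call {h w st q} (p : Fin n) (m : S.Method) (a : S.Arg m) :
      AtomicRun A h w st q → st p = Status.idle →
      AtomicRun A (h ++ [Action.call p m a]) w (Function.update st p (Status.called m a)) q
  | lin {h w st q q'} (p : Fin n) (o : Operation S) :
      AtomicRun A h w st q → st p = Status.called o.method o.arg → A.Tr q o q' →
      AtomicRun A h (w ++ [(p, o)]) (Function.update st p (Status.done o)) q'
  | ret {h w st q} (p : Fin n) (o : Operation S) :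
      AtomicRun A h w st q → st p = Status.done o →
      AtomicRun A (h ++ [Action.ret p o.method o.ret]) w (Function.update st p Status.idle) q

/-- The sequential history of a sequence of operations. -/
def seqHistory (w : List (Fin n × Operation S)) : List (Action S n) :=
  w.flatMap (fun x =>
    [Action.call x.1 x.2.method x.2.arg, Action.ret x.1 x.2.method x.2.ret])

theorem LTS.Path.snoc {L : Type} {A : LTS L} {q q' q'' : A.State} {t : List L} {b : L}
    (h : A.Path q t q') (h' : A.Tr q' b q'') : A.Path q (t ++ [b]) q'' := by
  induction h with
  | nil q => exact LTS.Path.cons h' (LTS.Path.nil _)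
  | cons h1 _ ih => exact LTS.Path.cons h1 (ih h')

@[simp] theorem subhistory_append (h h' : List (Action S n)) (p : Fin n) :
    subhistory (h ++ h') p = subhistory h p ++ subhistory h' p := by
  simp [subhistory]

@[simp] theorem subhistory_nil (p : Fin n) : subhistory ([] : List (Action S n)) p = [] := rfl

theorem subhistory_cons (e : Action S n) (h : List (Action S n)) (p : Fin n) :
    subhistory (e :: h) p = if e.proc = p then e :: subhistory h p else subhistory h p := by
  simp [subhistory, List.filter_cons]

@[simp] theorem seqHistory_nil : seqHistory ([] : List (Fin n × Operation S)) = [] := rfl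

@[simp] theorem seqHistory_cons (x : Fin n × Operation S) (w : List (Fin n × Operation S)) :
    seqHistory (x :: w) = Action.call x.1 x.2.method x.2.arg ::
      Action.ret x.1 x.2.method x.2.ret :: seqHistory w := by
  simp [seqHistory]

@[simp] theorem seqHistory_append (w w' : List (Fin n × Operation S)) :
    seqHistory (w ++ w') = seqHistory w ++ seqHistory w' := by
  simp [seqHistory]

theorem length_seqHistory (w : List (Fin n × Operation S)) :
    (seqHistory w).length = 2 * w.length := by
  induction w with
  | nil => rfl
  | cons x w ih => simp [ih]; ring

theorem countP_isCall_seqHistory (w : List (Fin n × Operation S)) (p : Fin n) :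
    (subhistory (seqHistory w) p).countP Action.isCall = w.countP (fun x => x.1 = p) := by
  induction w with
  | nil => rfl
  | cons x w ih =>
    by_cases hx : x.1 = p
    · simp only [seqHistory_cons, subhistory_cons, Action.proc, hx, if_true]
      rw [List.countP_cons_of_pos rfl, List.countP_cons_of_neg (by simp [Action.isCall]), ih,
        List.countP_cons_of_pos (by simpa using hx)]
    · simp [subhistory_cons, Action.proc, hx, ih]

theorem isSequential_seqHistory_append (w : List (Fin n × Operation S)) (p : Fin n)
    {t : List (Action S n)} (ht : IsSequential t) :
    IsSequential (subhistory (seqHistory w) p ++ t) := by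
  induction w with
  | nil => simpa using ht
  | cons x w ih =>
    by_cases hx : x.1 = p
    · simpa [subhistory_cons, Action.proc, hx] using IsSequential.cons _ _ _ _ ih
    · simpa [subhistory_cons, Action.proc, hx] using ih

/-- What a process has done, compared with the operations of it that took effect. -/
def Status.Agrees (p : Fin n) (h : List (Action S n)) (w : List (Fin n × Operation S)) :
    Status S → Prop
  | idle => subhistory h p = subhistory (seqHistory w) p
  | called m a => subhistory h p = subhistory (seqHistory w) p ++ [Action.call p m a]
  | done o => subhistory h p ++ [Action.ret p o.method o.ret] = subhistory (seqHistory w) p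

namespace AtomicRun

variable {A : LTS (Operation S)} {h : List (Action S n)} {w : List (Fin n × Operation S)}
  {st : Fin n → Status S} {q : A.State}

theorem path (hr : AtomicRun A h w st q) : A.Path A.init (w.map Prod.snd) q := by
  induction hr with
  | init => exact LTS.Path.nil _
  | call _ _ _ _ _ ih => exact ih
  | lin p o _ _ ht ih => simpa using ih.snoc ht
  | ret _ _ _ _ ih => exact ih

theorem agrees (hr : AtomicRun A h w st q) (p : Fin n) : (st p).Agrees p h w := by
  induction hr with
  | init => simp [Status.Agrees]
  | call p' m a _ hs ih =>
    by_cases hp : p' = p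
    · subst hp
      rw [hs] at ih
      simpa [Status.Agrees, subhistory_cons, Action.proc] using ih
    · rw [Function.update_of_ne (Ne.symm hp)]
      revert ih
      cases ‹Fin n → Status S› p <;> simp [Status.Agrees, subhistory_cons, Action.proc, hp]
  | lin p' o _ hs _ ih =>
    by_cases hp : p' = p
    · subst hp
      rw [hs] at ih
      simp only [Status.Agrees] at ih
      simp [Status.Agrees, subhistory_cons, Action.proc, ih]
    · rw [Function.update_of_ne (Ne.symm hp)]
      revert ih
      cases ‹Fin n → Status S› p <;> simp [Status.Agrees, subhistory_cons, Action.proc, hp]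
  | ret p' o _ hs ih =>
    by_cases hp : p' = p
    · subst hp
      rw [hs] at ih
      simpa [Status.Agrees, subhistory_cons, Action.proc] using ih
    · rw [Function.update_of_ne (Ne.symm hp)]
      revert ih
      cases ‹Fin n → Status S› p <;> simp [Status.Agrees, subhistory_cons, Action.proc, hp]

/-- Effects are only ever appended to `w`, so those that have occurred by the end of a prefix of the
history form a prefix of `w`. This is what transfers real-time order from `h` to `w`. -/
theorem of_prefix (hr : AtomicRun A h w st q) {h₁ : List (Action S n)} (hp : h₁ <+: h) :
    ∃ w₁ st₁ q₁, w₁ <+: w ∧ AtomicRun A h₁ w₁ st₁ q₁ := by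
  induction hr with
  | init =>
    obtain rfl := List.prefix_nil.1 hp
    exact ⟨_, _, _, List.prefix_rfl, AtomicRun.init⟩
  | call p m a hr hs ih =>
    rcases List.prefix_concat_iff.1 hp with rfl | hp
    · exact ⟨_, _, _, List.prefix_rfl, AtomicRun.call p m a hr hs⟩
    · exact ih hp
  | lin p o hr hs ht ih =>
    obtain ⟨w₁, st₁, q₁, hw, hr₁⟩ := ih hp
    exact ⟨w₁, st₁, q₁, hw.trans (List.prefix_append _ _), hr₁⟩
  | ret p o hr hs ih =>
    rcases List.prefix_concat_iff.1 hp with rfl | hp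
    · exact ⟨_, _, _, List.prefix_rfl, AtomicRun.ret p o hr hs⟩
    · exact ih hp

/-- This supplies the returns that linearizability allows to append: every operation that has taken
effect returns, one process at a time, while `w` stays the same. -/
theorem exists_returned (hr : AtomicRun A h w st q) :
    ∃ r st', (∀ e ∈ r, e.isRet = true) ∧ AtomicRun A (h ++ r) w st' q ∧
      ∀ p o, st' p ≠ Status.done o := by
  suffices H : ∀ s : Finset (Fin n), ∃ r st', (∀ e ∈ r, e.isRet = true) ∧
      AtomicRun A (h ++ r) w st' q ∧ ∀ p ∈ s, ∀ o, st' p ≠ Status.done o by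
    simpa using H Finset.univ
  intro s
  induction s using Finset.induction_on with
  | empty => exact ⟨[], st, by simp, by simpa using hr, by simp⟩
  | insert p s _ ih =>
    obtain ⟨r, st', h1, h2, h3⟩ := ih
    by_cases hd : ∃ o, st' p = Status.done o
    · obtain ⟨o, ho⟩ := hd
      refine ⟨r ++ [Action.ret p o.method o.ret], Function.update st' p Status.idle, ?_, ?_, ?_⟩
      · intro e he
        rcases List.mem_append.1 he with he | he
        · exact h1 e he
        · obtain rfl := List.mem_singleton.1 he
          rfl
      · simpa using AtomicRun.ret p o h2 ho
      · intro p' hp' o'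
        by_cases hpp : p' = p
        · subst hpp; simp
        · rw [Function.update_of_ne hpp]
          exact h3 p' (Finset.mem_of_mem_insert_of_ne hp' hpp) o'
    · refine ⟨r, st', h1, h2, ?_⟩
      intro p' hp' o'
      rcases Finset.mem_insert.1 hp' with rfl | hp'
      · exact fun hc => hd ⟨o', hc⟩
      · exact h3 p' hp' o'

end AtomicRun

/-! ### Matched actions -/

theorem Matches.append_right {h : List (Action S n)} {i j : ℕ} (hm : Matches h i j)
    (t : List (Action S n)) : Matches (h ++ t) i j := by
  obtain ⟨hij, p, m, a, b, hi, hj, hk⟩ := hm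
  have hjl : j < h.length := (List.getElem?_eq_some_iff.1 hj).1
  refine ⟨hij, p, m, a, b, ?_, ?_, ?_⟩
  · rwa [List.getElem?_append_left (by omega)]
  · rwa [List.getElem?_append_left (by omega)]
  · intro k h1 h2 e he
    rw [List.getElem?_append_left (by omega)] at he
    exact hk k h1 h2 e he

theorem Matches.append_left {h : List (Action S n)} {i j : ℕ} (hm : Matches h i j)
    (t : List (Action S n)) : Matches (t ++ h) (t.length + i) (t.length + j) := by
  obtain ⟨hij, p, m, a, b, hi, hj, hk⟩ := hm
  refine ⟨by omega, p, m, a, b, ?_, ?_, ?_⟩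
  · rw [List.getElem?_append_right (by omega)]; simpa using hi
  · rw [List.getElem?_append_right (by omega)]; simpa using hj
  · intro k h1 h2 e he
    rw [List.getElem?_append_right (by omega)] at he
    exact hk (k - t.length) (by omega) (by omega) e he

theorem matches_of_no_action_between {p : Fin n} {m : S.Method} {a : S.Arg m} {b : S.Ret m}
    {h₁ h₂ : List (Action S n)} (h₃ : List (Action S n)) (hno : ∀ e ∈ h₂, e.proc ≠ p) :
    Matches (h₁ ++ Action.call p m a :: (h₂ ++ Action.ret p m b :: h₃))
      h₁.length (h₁.length + (h₂.length + 1)) := by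
  refine ⟨by omega, p, m, a, b, by simp, ?_, ?_⟩
  · rw [List.getElem?_append_right (by omega)]
    simp
  · intro k h1 h2 e he
    rw [List.getElem?_append_right (by omega)] at he
    obtain ⟨k, rfl⟩ : ∃ k', k = h₁.length + (k' + 1) := ⟨k - h₁.length - 1, by omega⟩
    rw [Nat.add_sub_cancel_left, List.getElem?_cons_succ,
      List.getElem?_append_left (by omega)] at he
    exact hno e (List.mem_of_getElem? he)

/-- Induction on `w`: the first operation of `p` locates a call and a return in `h` with only
foreign actions before and between them. The part of `h` behind this return falls under the
induction hypothesis, and its matches shift back to `h`. -/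
theorem exists_matches_of_subhistory_eq {p : Fin n} (w : List (Fin n × Operation S)) :
    ∀ {h : List (Action S n)}, subhistory h p = subhistory (seqHistory w) p →
      ∀ {i : ℕ} {e : Action S n}, h[i]? = some e → e.proc = p →
        ∃ j, Matches h i j ∨ Matches h j i := by
  induction w with
  | nil =>
    intro h hh i e he hp
    have : e ∈ subhistory h p := by
      simp [subhistory, List.mem_of_getElem? he, hp]
    rw [hh] at this
    simp at this
  | cons x w ih =>
    intro h hh i e he hp
    by_cases hx : x.1 = p
    · simp only [seqHistory_cons, subhistory_cons, Action.proc, hx, if_true] at hh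
      obtain ⟨h₁, t, rfl, hn1, -, ht⟩ := List.filter_eq_cons_iff.1 hh
      obtain ⟨h₂, h₃, rfl, hn2, -, ht'⟩ := List.filter_eq_cons_iff.1 ht
      have hm := matches_of_no_action_between (h₁ := h₁) (m := x.2.method) (a := x.2.arg)
        (b := x.2.ret) h₃ (by simpa using hn2)
      rcases Nat.lt_trichotomy i h₁.length with hi | hi | hi
      · rw [List.getElem?_append_left hi] at he
        exact absurd hp (by simpa using hn1 e (List.mem_of_getElem? he))
      · exact ⟨_, Or.inl (hi ▸ hm)⟩
      · obtain ⟨i, rfl⟩ : ∃ i', i = h₁.length + (i' + 1) := ⟨i - h₁.length - 1, by omega⟩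
        have he' := he
        rw [List.getElem?_append_right (by omega), Nat.add_sub_cancel_left,
          List.getElem?_cons_succ] at he'
        rcases Nat.lt_trichotomy i h₂.length with hi' | hi' | hi'
        · rw [List.getElem?_append_left hi'] at he'
          exact absurd hp (by simpa using hn2 e (List.mem_of_getElem? he'))
        · exact ⟨_, Or.inr (hi' ▸ hm)⟩
        · obtain ⟨i, rfl⟩ : ∃ i', i = h₂.length + (i' + 1) := ⟨i - h₂.length - 1, by omega⟩
          rw [List.getElem?_append_right (by omega), Nat.add_sub_cancel_left,
            List.getElem?_cons_succ] at he'
          obtain ⟨j, hj⟩ := ih ht' he' hp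
          have key : ∀ {i j}, Matches h₃ i j →
              Matches (h₁ ++ Action.call p x.2.method x.2.arg ::
                (h₂ ++ Action.ret p x.2.method x.2.ret :: h₃))
                (h₁.length + (h₂.length + (i + 1) + 1)) (h₁.length + (h₂.length + (j + 1) + 1)) := by
            intro i j hij
            have := hij.append_left (h₁ ++ Action.call p x.2.method x.2.arg ::
                (h₂ ++ [Action.ret p x.2.method x.2.ret]))
            simpa [add_assoc, add_comm, add_left_comm] using this
          exact ⟨_, hj.imp key key⟩
    · simp only [seqHistory_cons, subhistory_cons, Action.proc, hx, if_false] at hh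
      exact ih hh he hp

open Classical in
/-- The entries of `l` at the positions that satisfy `P`. -/
noncomputable def selectAt {α : Type} (l : List α) (P : ℕ → Prop) : List α :=
  ((List.finRange l.length).filter (fun i : Fin l.length => decide (P i))).map l.get

open Classical in
theorem selectAt_cons {α : Type} (x : α) (l : List α) (P : ℕ → Prop) :
    selectAt (x :: l) P = (if P 0 then [x] else []) ++ selectAt l (fun i => P (i + 1)) := by
  unfold selectAt
  change List.map (x :: l).get (List.filter _ (List.finRange (l.length + 1))) = _
  rw [List.finRange_succ, List.filter_cons]
  split_ifs with h1 h2 h2 <;>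
    simp_all [List.filter_map, Function.comp_def]

theorem selectAt_append {α : Type} (l l' : List α) (P : ℕ → Prop) :
    selectAt (l ++ l') P = selectAt l P ++ selectAt l' (fun i => P (l.length + i)) := by
  induction l generalizing P with
  | nil =>
    simp only [List.length_nil, Nat.zero_add]
    simp [selectAt]
  | cons x l ih =>
    simp [selectAt_cons, ih, add_right_comm]

/-- Used with `f` for "belongs to `p`" and `P` for "is matched": deleting unmatched actions does not
affect a process all of whose actions are matched. -/
theorem filter_selectAt {α : Type} (f : α → Bool) (l : List α) (P : ℕ → Prop)
    (hP : ∀ i x, l[i]? = some x → f x = true → P i) :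
    (selectAt l P).filter f = l.filter f := by
  induction l generalizing P with
  | nil => simp [selectAt]
  | cons x l ih =>
    rw [selectAt_cons, List.filter_append, ih _ (fun i y hy => hP (i + 1) y (by simpa using hy))]
    have h0 := hP 0 x (by simp)
    by_cases hx : f x = true
    · simp [h0 hx, hx]
    · by_cases h : P 0 <;> simp [h, hx]

theorem filter_selectAt_eq_nil {α : Type} (f : α → Bool) (l : List α) (P : ℕ → Prop)
    (hl : ∀ x ∈ l, f x = false) : (selectAt l P).filter f = [] := by
  rw [List.filter_eq_nil_iff]
  intro x hx
  unfold selectAt at hx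
  obtain ⟨i, -, rfl⟩ := List.mem_map.1 hx
  simpa using hl _ (l.get_mem i)

theorem complete_eq_selectAt (h : List (Action S n)) :
    complete h = selectAt h (fun i => ∃ j : ℕ, Matches h i j ∨ Matches h j i) := rfl

theorem subhistory_complete_of_eq {h : List (Action S n)} {p : Fin n}
    {w : List (Fin n × Operation S)} (hh : subhistory h p = subhistory (seqHistory w) p) :
    subhistory (complete h) p = subhistory (seqHistory w) p := by
  rw [complete_eq_selectAt, ← hh]
  exact filter_selectAt _ _ _ fun i e he hp =>
    exists_matches_of_subhistory_eq w hh he (by simpa using hp)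

/-- The pending call is the last action of `p`, so nothing can match it and it is deleted. The
earlier actions of `p` are already matched within `h₁`, and matches survive appending. -/
theorem subhistory_complete_of_eq_append {h : List (Action S n)} {p : Fin n}
    {w : List (Fin n × Operation S)} {m : S.Method} {a : S.Arg m}
    (hh : subhistory h p = subhistory (seqHistory w) p ++ [Action.call p m a]) :
    subhistory (complete h) p = subhistory (seqHistory w) p := by
  obtain ⟨h₁, h₂, rfl, hh1, hh2⟩ := List.filter_eq_append_iff.1 hh
  obtain ⟨h₃, h₄, rfl, hn3, -, hn4⟩ := List.filter_eq_cons_iff.1 hh2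
  have hn4 : ∀ e ∈ h₄, ¬ e.proc = p := by simpa using hn4
  have hn3 : ∀ e ∈ h₃, ¬ e.proc = p := by simpa using hn3
  have hc : (h₁ ++ (h₃ ++ Action.call p m a :: h₄))[h₁.length + h₃.length]? =
      some (Action.call p m a) := by
    rw [List.getElem?_append_right (by omega)]; simp
  rw [complete_eq_selectAt, subhistory, selectAt_append, selectAt_append, selectAt_cons]
  simp only [List.filter_append]
  rw [filter_selectAt _ h₁, filter_selectAt_eq_nil _ h₃, filter_selectAt_eq_nil _ h₄, if_neg]
  · rw [← hh1]; simp
  · rintro ⟨j, hm | hm⟩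
    · obtain ⟨hij, p', m', a', b', hi, hj, -⟩ := hm
      simp only [add_zero] at hi hij
      rw [hc] at hi
      obtain ⟨j, rfl⟩ : ∃ j', j = h₁.length + (h₃.length + (j' + 1)) :=
        ⟨j - h₁.length - h₃.length - 1, by omega⟩
      rw [List.getElem?_append_right (by omega), Nat.add_sub_cancel_left,
        List.getElem?_append_right (by omega), Nat.add_sub_cancel_left,
        List.getElem?_cons_succ] at hj
      refine hn4 _ (List.mem_of_getElem? hj) ?_
      simp only [Option.some.injEq, Action.call.injEq] at hi
      exact hi.1.symm
    · obtain ⟨-, p', m', a', b', -, hj, -⟩ := hm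
      simp only [add_zero] at hj
      rw [hc] at hj
      simp at hj
  · simpa using hn4
  · simpa using hn3
  · intro i e he hp
    obtain ⟨j, hj⟩ := exists_matches_of_subhistory_eq w hh1 he (by simpa using hp)
    exact ⟨j, hj.imp (fun hm => hm.append_right _) (fun hm => hm.append_right _)⟩

/-! ### Operations of sequential histories -/

theorem exists_nth_of_lt_countP {α : Type} (f : α → Bool) :
    ∀ (l : List α) {k : ℕ}, k < l.countP f →
      ∃ l₁ x l₂, l = l₁ ++ x :: l₂ ∧ f x = true ∧ l₁.countP f = k := by
  intro l
  induction l with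
  | nil => intro k hk; simp at hk
  | cons y l ih =>
    intro k hk
    by_cases hy : f y = true
    · rcases k with _ | k
      · exact ⟨[], y, l, rfl, hy, rfl⟩
      · rw [List.countP_cons_of_pos hy] at hk
        obtain ⟨l₁, x, l₂, rfl, hx, hc⟩ := ih (Nat.lt_of_succ_lt_succ hk)
        exact ⟨y :: l₁, x, l₂, rfl, hx, by rw [List.countP_cons_of_pos hy, hc]⟩
    · rw [List.countP_cons_of_neg hy] at hk
      obtain ⟨l₁, x, l₂, rfl, hx, hc⟩ := ih hk
      exact ⟨y :: l₁, x, l₂, rfl, hx, by rw [List.countP_cons_of_neg hy, hc]⟩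

theorem invAt_seqHistory (w₁ w₂ : List (Fin n × Operation S)) (x : Fin n × Operation S) :
    InvAt (seqHistory (w₁ ++ x :: w₂)) (x.1, w₁.countP (fun y => y.1 = x.1)) (2 * w₁.length) := by
  rw [← length_seqHistory, seqHistory_append, seqHistory_cons]
  refine ⟨⟨x.2.method, x.2.arg, by simp⟩, ?_⟩
  rw [List.take_left, countP_isCall_seqHistory]

theorem resAt_seqHistory (w₁ w₂ : List (Fin n × Operation S)) (x : Fin n × Operation S) :
    ResAt (seqHistory (w₁ ++ x :: w₂)) (x.1, w₁.countP (fun y => y.1 = x.1))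
      (2 * w₁.length + 1) := by
  refine ⟨_, invAt_seqHistory w₁ w₂ x, ?_⟩
  rw [← length_seqHistory, seqHistory_append, seqHistory_cons]
  exact matches_of_no_action_between (h₂ := []) _ (by simp)

/-- Operations are named by process and number, so lying in the prefix `w₁` is a matter of counting:
`o₁` lies in `w₁`, while `o₂` lies in `w` beyond `w₁`. -/
theorem happensBefore_seqHistory {w₁ w : List (Fin n × Operation S)} (hp : w₁ <+: w)
    {o₁ o₂ : Fin n × ℕ} (h₁ : o₁.2 < w₁.countP (fun y => y.1 = o₁.1))
    (h₂ : w₁.countP (fun y => y.1 = o₂.1) ≤ o₂.2) (h₂' : o₂.2 < w.countP (fun y => y.1 = o₂.1)) :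
    HappensBefore (seqHistory w) o₁ o₂ := by
  obtain ⟨p₁, k₁⟩ := o₁
  obtain ⟨p₂, k₂⟩ := o₂
  obtain ⟨u₁, x, u₂, hw₁, hx, hu⟩ := exists_nth_of_lt_countP _ _ h₁
  obtain ⟨v₁, y, v₂, hw, hy, hv⟩ := exists_nth_of_lt_countP _ _ h₂'
  obtain rfl : x.1 = p₁ := by simpa using hx
  obtain rfl : y.1 = p₂ := by simpa using hy
  simp only at hu hv h₂
  have hlen : w₁.length ≤ v₁.length := by
    -- Otherwise `w₁` would contain `v₁ ++ [y]`, hence more than `k₂` operations of the process of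
    -- `y`, against `h₂`.
    by_contra hlt
    have hpre : v₁ ++ [y] <+: w₁ := by
      refine List.prefix_of_prefix_length_le (l₃ := w) ⟨v₂, by simp [hw]⟩ hp ?_
      simp; omega
    have := hpre.sublist.countP_le (p := fun z => decide (z.1 = y.1))
    simp [List.countP_append, hv] at this
    omega
  refine ⟨2 * u₁.length + 1, 2 * v₁.length, ?_, ?_, ?_⟩
  · obtain ⟨t, rfl⟩ := hp
    have := resAt_seqHistory u₁ (u₂ ++ t) x
    rw [hu] at this
    simpa [hw₁] using this
  · have := invAt_seqHistory v₁ v₂ y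
    rw [hv] at this
    rwa [hw]
  · have : w₁.length = u₁.length + (u₂.length + 1) := by simp [hw₁]
    omega

theorem Matches.proc_eq {h : List (Action S n)} {o : Fin n × ℕ} {i j : ℕ}
    (hi : InvAt h o i) (hm : Matches h i j) :
    ∃ (m : S.Method) (a : S.Arg m) (b : S.Ret m), h[i]? = some (Action.call o.1 m a) ∧
      h[j]? = some (Action.ret o.1 m b) := by
  obtain ⟨⟨m, a, hi⟩, -⟩ := hi
  obtain ⟨-, p', m', a', b', hi', hj, -⟩ := hm
  have heq := hi.symm.trans hi'
  simp only [Option.some.injEq, Action.call.injEq] at heq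
  obtain ⟨rfl, rfl, -⟩ := heq
  exact ⟨_, _, _, hi, hj⟩

theorem take_succ_eq {α : Type} {l : List α} {i : ℕ} {x : α} (h : l[i]? = some x) :
    l.take (i + 1) = l.take i ++ [x] := by
  rw [List.take_add_one, h]; rfl

theorem lt_countP_isCall_of_invAt {h : List (Action S n)} {o : Fin n × ℕ} {i j : ℕ}
    (hi : InvAt h o i) (hij : i < j) :
    o.2 < (subhistory (h.take j) o.1).countP Action.isCall := by
  obtain ⟨⟨m, a, hc⟩, hk⟩ := hi
  have hpre : h.take (i + 1) <+: h.take j := List.take_prefix_take_left (by omega)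
  have := (hpre.sublist.filter (fun e => decide (e.proc = o.1))).countP_le (p := Action.isCall)
  rw [take_succ_eq hc] at this
  change List.countP Action.isCall (subhistory _ _) ≤
    List.countP Action.isCall (subhistory _ _) at this
  rw [subhistory_append, List.countP_append, hk] at this
  simp [subhistory_cons, Action.proc, Action.isCall] at this
  omega

theorem countP_isCall_take_le {h : List (Action S n)} (p : Fin n) {i j : ℕ} (hij : i ≤ j) :
    (subhistory (h.take i) p).countP Action.isCall ≤
      (subhistory (h.take j) p).countP Action.isCall :=
  ((List.take_prefix_take_left hij).sublist.filter _).countP_le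

/-- No operation takes effect before its call. -/
theorem Status.Agrees.countP_le {p : Fin n} {h : List (Action S n)}
    {w : List (Fin n × Operation S)} {s : Status S} (hs : s.Agrees p h w) :
    w.countP (fun x => x.1 = p) ≤ (subhistory h p).countP Action.isCall := by
  rw [← countP_isCall_seqHistory]
  cases s with
  | idle => rw [Status.Agrees] at hs; rw [hs]
  | called m a => rw [Status.Agrees] at hs; rw [hs]; simp
  | done o => rw [Status.Agrees] at hs; rw [← hs]; simp [Action.isCall]

/-- Right after a return, the process has no call that still awaits its effect. -/
theorem Status.Agrees.countP_isCall_le {p : Fin n} {h t : List (Action S n)}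
    {w : List (Fin n × Operation S)} {s : Status S} (hs : s.Agrees p h w)
    {m : S.Method} {b : S.Ret m} (ht : subhistory h p = t ++ [Action.ret p m b]) :
    (subhistory h p).countP Action.isCall ≤ w.countP (fun x => x.1 = p) := by
  rw [← countP_isCall_seqHistory]
  cases s with
  | idle => rw [Status.Agrees] at hs; rw [hs]
  | called m a =>
    rw [Status.Agrees, ht] at hs
    simp at hs
  | done o => rw [Status.Agrees] at hs; rw [← hs]; simp

/-- An operation without effect is a pending call, and that is the last action of its process. It
thus lies behind the return of the complete operation and is not among the calls counted up to that
return. -/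
theorem Status.Agrees.lt_countP {p : Fin n} {h : List (Action S n)}
    {w : List (Fin n × Operation S)} {s : Status S} (hs : s.Agrees p h w)
    {k : ℕ} (hc : IsCompleteOp h (p, k)) (hd : ∀ o, s ≠ Status.done o) :
    k < w.countP (fun x => x.1 = p) := by
  obtain ⟨j, i, hi, hm⟩ := hc
  have hk := lt_countP_isCall_of_invAt hi hm.1
  simp only at hk
  rw [← countP_isCall_seqHistory]
  have hsplit : h.take j ++ h.drop j = h := List.take_append_drop j h
  cases s with
  | idle =>
    rw [Status.Agrees] at hs
    rw [← hs, ← hsplit, subhistory_append, List.countP_append]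
    omega
  | called m a =>
    rw [Status.Agrees, ← hsplit, subhistory_append] at hs
    obtain ⟨m', a', b', -, hj⟩ := hm.proc_eq hi
    obtain ⟨hjl, hj⟩ := List.getElem?_eq_some_iff.1 hj
    rw [List.drop_eq_getElem_cons hjl, hj, subhistory_cons] at hs
    simp only [Action.proc, if_true] at hs
    rcases List.eq_nil_or_concat (subhistory (h.drop (j + 1)) p) with ht | ⟨t, e, ht⟩
    · rw [ht] at hs
      simp at hs
    · rw [ht, List.concat_eq_append] at hs
      obtain ⟨hs1, hs2⟩ := List.append_inj' (s₁ := subhistory (h.take j) p ++ Action.ret p m' b' :: t)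
        (s₂ := subhistory (seqHistory w) p) (t₁ := [e]) (t₂ := [Action.call p m a])
        (by simpa using hs) rfl
      rw [← hs1, List.countP_append]
      omega
  | done o => exact absurd rfl (hd o)

/-- Histories of atomic objects are linearizable. -/
theorem AtomicRun.linearizableHistory {A : LTS (Operation S)} {h : List (Action S n)}
    {w : List (Fin n × Operation S)} {st : Fin n → Status S} {q : A.State}
    (hr : AtomicRun A h w st q) : LinearizableHistory (SeqSpec.ofLTS A) h := by
  obtain ⟨r, st', hret, hr', hnd⟩ := hr.exists_returned
  refine ⟨r, hret, ?_, seqHistory w, ⟨w, ⟨q, hr.path⟩, rfl⟩, ?_, ?_⟩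
  · intro p
    have hp := hr'.agrees p
    revert hp
    cases hs : st' p with
    | idle =>
      intro hp
      rw [Status.Agrees] at hp
      rw [hp]
      simpa using isSequential_seqHistory_append w p IsSequential.nil
    | called m a =>
      intro hp
      rw [Status.Agrees] at hp
      rw [hp]
      exact isSequential_seqHistory_append w p (IsSequential.pending _ _ _)
    | done o => exact absurd hs (hnd p o)
  · intro p
    have hp := hr'.agrees p
    revert hp
    cases hs : st' p with
    | idle => exact subhistory_complete_of_eq
    | called m a => exact subhistory_complete_of_eq_append
    | done o => exact absurd hs (hnd p o)
  · rintro o₁ o₂ - hc ⟨j, i, ⟨i₁, hi₁, hm⟩, hi, hji⟩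
    -- The run is cut just after the return of `o₁` at position `j`, hence the length `j + 1`. By
    -- then `o₁` has taken effect, and `o₂`, called at `i > j`, has not.
    obtain ⟨w₁, st₁, q₁, hw₁, hr₁⟩ := hr.of_prefix (List.take_prefix (j + 1) h)
    obtain ⟨m, a, b, -, hj⟩ := hm.proc_eq hi₁
    refine happensBefore_seqHistory hw₁ ?_ ?_ ?_
    · have h1 := lt_countP_isCall_of_invAt hi₁ (Nat.lt_succ_of_lt hm.1)
      refine h1.trans_le ((hr₁.agrees o₁.1).countP_isCall_le (t := subhistory (h.take j) o₁.1)
        (m := m) (b := b) ?_)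
      rw [take_succ_eq hj, subhistory_append]
      simp [subhistory_cons, Action.proc]
    · refine (hr₁.agrees o₂.1).countP_le.trans ?_
      exact (countP_isCall_take_le o₂.1 hji).trans_eq hi.2
    · exact (hr'.agrees o₂.1).lt_countP hc (hnd _)

end AtomicRuns

end HWQ

namespace HWQ

/-! ## The Herlihy–Wing queue with ghost variables -/

/-- The state of a process of the Herlihy–Wing queue. Enqueue operations carry an identifier. -/
inductive PState : Type
  | idle
  | enq (e : ℕ) (s : EnqState)
  | deq (s : DeqState)

/-- The process state without the identifier. -/
def PState.toLocal : PState → Option (Σ m : QMethod, hwq.Local m)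
  | idle => none
  | enq _ s => some ⟨QMethod.enq, s⟩
  | deq s => some ⟨QMethod.deq, s⟩

/-- Configurations of the Herlihy–Wing queue with ghost variables. Enqueue operations are numbered
in the order of their calls. -/
structure Ghost (n : ℕ) where
  shared : HWShared
  procs : Fin n → PState
  /-- the number of enqueue operations called so far -/
  size : ℕ
  /-- the enqueued values -/
  val : ℕ → ℕ
  /-- the indices at which the values are stored, `0` if not yet determined -/
  slot : ℕ → ℕ
  /-- the first operation returned before the second one was called -/
  hb : ℕ → ℕ → Prop
  /-- the operation has stored its value -/
  written : ℕ → Prop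
  /-- the value has been removed -/
  taken : ℕ → Prop
  /-- the operation has returned -/
  returned : ℕ → Prop

namespace Ghost

variable {n : ℕ}

/-- What a dequeue operation knows. A scan that has passed `e₁` without finding its value will
not meet a value enqueued after the return of `e₁`. -/
def DeqInv (G : Ghost n) : DeqState → Prop
  | DeqState.D2 l => 1 ≤ l ∧ l ≤ G.shared.X
  | DeqState.D3 l j => j < l ∧ l ≤ G.shared.X ∧
      ∀ e₁ e₂, 1 ≤ G.slot e₁ → G.slot e₁ < j → ¬ G.taken e₁ → 1 ≤ G.slot e₂ → G.slot e₂ < l →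
        ¬ G.hb e₁ e₂
  | _ => True

/-- What an enqueue operation `e` knows. -/
def EnqInv (G : Ghost n) (e : ℕ) : EnqState → Prop
  | EnqState.E1 v => G.slot e = 0 ∧ G.val e = v ∧ ¬ G.written e
  | EnqState.E2 v i => G.slot e = i ∧ 1 ≤ i ∧ G.val e = v ∧ ¬ G.written e
  | EnqState.E3 => G.written e

/-- The invariant of the Herlihy–Wing queue. -/
structure Inv (G : Ghost n) : Prop where
  one_le_X : 1 ≤ G.shared.X
  enq_lt : ∀ p e s, G.procs p = PState.enq e s → e < G.size
  enq_not_returned : ∀ p e s, G.procs p = PState.enq e s → ¬ G.returned e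
  owner_inj : ∀ p p' e s s', G.procs p = PState.enq e s → G.procs p' = PState.enq e s' → p = p'
  exists_owner : ∀ e, e < G.size → ¬ G.returned e → ∃ p s, G.procs p = PState.enq e s
  enqInv : ∀ p e s, G.procs p = PState.enq e s → G.EnqInv e s
  deqInv : ∀ p s, G.procs p = PState.deq s → G.DeqInv s
  written_of_returned : ∀ e, G.returned e → G.written e
  written_of_taken : ∀ e, G.taken e → G.written e
  slot_of_written : ∀ e, G.written e → 1 ≤ G.slot e
  lt_of_slot : ∀ e, 1 ≤ G.slot e → e < G.size
  slot_lt_X : ∀ e, G.slot e < G.shared.X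
  slot_inj : ∀ e e', 1 ≤ G.slot e → G.slot e = G.slot e' → e = e'
  returned_of_hb : ∀ x y, G.hb x y → G.returned x
  lt_of_hb : ∀ x y, G.hb x y → x < y
  lt_size_of_hb : ∀ x y, G.hb x y → y < G.size
  slot_lt_of_hb : ∀ x y, G.hb x y → 1 ≤ G.slot y → G.slot x < G.slot y
  read : ∀ e, G.written e → ¬ G.taken e → G.shared.Q (G.slot e) = some (G.val e)
  exists_of_read : ∀ j v, G.shared.Q j = some v →
    ∃ e, G.written e ∧ ¬ G.taken e ∧ G.slot e = j ∧ G.val e = v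

/-- Change the state of a process. -/
def setProc (G : Ghost n) (p : Fin n) (s : PState) : Ghost n :=
  { G with procs := Function.update G.procs p s }

/-- Call of `enq(v)`. -/
def callEnq (G : Ghost n) (p : Fin n) (v : ℕ) : Ghost n :=
  { G with
    procs := Function.update G.procs p (PState.enq G.size (EnqState.E1 v))
    size := G.size + 1
    val := Function.update G.val G.size v
    hb := fun x y => G.hb x y ∨ (G.returned x ∧ y = G.size) }

/-- The step `E1` of the operation `e`. -/
def getSlot (G : Ghost n) (p : Fin n) (e v : ℕ) : Ghost n :=
  { G with
    shared := { G.shared with X := G.shared.X + 1 }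
    procs := Function.update G.procs p (PState.enq e (EnqState.E2 v G.shared.X))
    slot := Function.update G.slot e G.shared.X }

/-- The step `E2` of the operation `e`. -/
def write (G : Ghost n) (p : Fin n) (e v i : ℕ) : Ghost n :=
  { G with
    shared := { G.shared with Q := Function.update G.shared.Q i (some v) }
    procs := Function.update G.procs p (PState.enq e EnqState.E3)
    written := fun x => x = e ∨ G.written x }

/-- Return of the operation `e`. -/
def retEnq (G : Ghost n) (p : Fin n) (e : ℕ) : Ghost n :=
  { G with
    procs := Function.update G.procs p PState.idle
    returned := fun x => x = e ∨ G.returned x }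

/-- Removal of the value `x` of the operation `e` from the index `j`. -/
def take (G : Ghost n) (p : Fin n) (e j x : ℕ) : Ghost n :=
  { G with
    shared := { G.shared with Q := Function.update G.shared.Q j none }
    procs := Function.update G.procs p (PState.deq (DeqState.D4 x))
    taken := fun y => y = e ∨ G.taken y }

/-! ### Preservation of the invariant -/

/-- Serves the call and the return of a dequeue and all its steps that leave the memory unchanged.
-/
theorem inv_setProc {G : Ghost n} (hG : G.Inv) {p : Fin n} {s : PState}
    (hp : ∀ e t, G.procs p ≠ PState.enq e t) (hs : ∀ e t, s ≠ PState.enq e t)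
    (hd : ∀ t, s = PState.deq t → G.DeqInv t) : (G.setProc p s).Inv := by
  have hd' : ∀ t, (G.setProc p s).DeqInv t ↔ G.DeqInv t := by intro t; cases t <;> rfl
  have he' : ∀ e t, (G.setProc p s).EnqInv e t ↔ G.EnqInv e t := by intro e t; cases t <;> rfl
  have hq : ∀ p' e t, (G.setProc p s).procs p' = PState.enq e t ↔ G.procs p' = PState.enq e t := by
    intro p' e t
    simp only [setProc, Function.update_apply]
    split_ifs with h
    · simp [h, hp, hs]
    · rfl
  exact { hG with
    enq_lt := fun p' e t h => hG.enq_lt p' e t ((hq _ _ _).1 h)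
    enq_not_returned := fun p' e t h => hG.enq_not_returned p' e t ((hq _ _ _).1 h)
    owner_inj := fun p' p'' e t t' h h' =>
      hG.owner_inj p' p'' e t t' ((hq _ _ _).1 h) ((hq _ _ _).1 h')
    exists_owner := fun e h h' => by simpa only [hq] using hG.exists_owner e h h'
    enqInv := fun p' e t h => (he' _ _).2 (hG.enqInv p' e t ((hq _ _ _).1 h))
    deqInv := fun p' t h => (hd' _).2 <| by
      simp only [setProc, Function.update_apply] at h
      split_ifs at h with h'
      · exact hd t h
      · exact hG.deqInv p' t h }

/-- Every new pair of `hb` ends in the fresh identifier `G.size`, whose slot is still `0`. The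
clauses guarded by a positive slot of the later operation say nothing about it. -/
theorem inv_callEnq {G : Ghost n} (hG : G.Inv) {p : Fin n} {v : ℕ}
    (hp : G.procs p = PState.idle) : (G.callEnq p v).Inv := by
  have hlt : ∀ e, G.written e → e < G.size := fun e h => hG.lt_of_slot e (hG.slot_of_written e h)
  have hs : G.slot G.size = 0 := by
    have := hG.lt_of_slot G.size; omega
  have hw : ¬ G.written G.size := fun h => (hlt _ h).false
  have hr : ¬ G.returned G.size := fun h => hw (hG.written_of_returned _ h)
  have hq : ∀ p' e t, (G.callEnq p v).procs p' = PState.enq e t →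
      (p' = p ∧ e = G.size ∧ t = EnqState.E1 v) ∨
      (p' ≠ p ∧ e < G.size ∧ G.procs p' = PState.enq e t) := by
    intro p' e t
    simp only [callEnq, Function.update_apply]
    have := hG.enq_lt p' e t
    grind
  have hb : ∀ x y, (G.callEnq p v).hb x y → G.hb x y ∨ (G.returned x ∧ y = G.size) :=
    fun _ _ h => h
  exact { hG with
    enq_lt := fun p' e t h => by
      change e < G.size + 1
      rcases hq p' e t h with h | h <;> omega
    enq_not_returned := fun p' e t h => by
      rcases hq p' e t h with ⟨-, rfl, -⟩ | h
      · exact hr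
      · exact hG.enq_not_returned p' e t h.2.2
    owner_inj := fun p' p'' e t t' h h' => by
      rcases hq p' e t h with h | h <;> rcases hq p'' e t' h' with h' | h'
      · rw [h.1, h'.1]
      · omega
      · omega
      · exact hG.owner_inj p' p'' e t t' h.2.2 h'.2.2
    exists_owner := fun e h h' => by
      change e < G.size + 1 at h
      rcases Nat.lt_succ_iff_lt_or_eq.1 h with h | rfl
      · obtain ⟨p', t, hp'⟩ := hG.exists_owner e h h'
        have hne : p' ≠ p := by rintro rfl; simp [hp] at hp'
        exact ⟨p', t, by simpa [callEnq, hne] using hp'⟩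
      · exact ⟨p, EnqState.E1 v, by simp [callEnq]⟩
    enqInv := fun p' e t h => by
      rcases hq p' e t h with ⟨-, rfl, rfl⟩ | ⟨-, h1, h2⟩
      · exact ⟨hs, by simp [callEnq], hw⟩
      · have := hG.enqInv p' e t h2
        cases t <;> simpa [EnqInv, callEnq, h1.ne] using this
    deqInv := fun p' t h => by
      have h' : G.procs p' = PState.deq t := by
        simp only [callEnq, Function.update_apply] at h
        grind
      have := hG.deqInv p' t h'
      cases t with
      | D3 l j =>
        refine ⟨this.1, this.2.1, fun e₁ e₂ h1 h2 h3 h4 h5 h6 => ?_⟩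
        rcases hb _ _ h6 with h6 | ⟨-, rfl⟩
        · exact this.2.2 e₁ e₂ h1 h2 h3 h4 h5 h6
        · change 1 ≤ G.slot G.size at h4; omega
      | _ => exact this
    lt_of_slot := fun e h => (hG.lt_of_slot e h).trans (Nat.lt_succ_self _)
    returned_of_hb := fun x y h => (hb x y h).elim (hG.returned_of_hb x y) And.left
    lt_of_hb := fun x y h => (hb x y h).elim (hG.lt_of_hb x y) fun h =>
      h.2 ▸ hlt x (hG.written_of_returned x h.1)
    lt_size_of_hb := fun x y h => (hb x y h).elim
      (fun h => (hG.lt_size_of_hb x y h).trans (Nat.lt_succ_self _))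
      fun h => h.2 ▸ Nat.lt_succ_self _
    slot_lt_of_hb := fun x y h h' => (hb x y h).elim (fun h => hG.slot_lt_of_hb x y h h') fun h => by
      obtain ⟨-, rfl⟩ := h
      change 1 ≤ G.slot G.size at h'; omega
    read := fun e h h' => by
      have := (hlt e h).ne
      simpa [callEnq, this] using hG.read e h h'
    exists_of_read := fun j u h => by
      obtain ⟨e, h1, h2, h3, h4⟩ := hG.exists_of_read j u h
      have := (hlt e h1).ne
      exact ⟨e, h1, h2, h3, by simpa [callEnq, this] using h4⟩ }

theorem procs_eq_of_update_enq {G : Ghost n} (hG : G.Inv) {p : Fin n} {e : ℕ} {t t' : EnqState}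
    (hp : G.procs p = PState.enq e t) {p' : Fin n} {e' : ℕ} {u : EnqState}
    (h : Function.update G.procs p (PState.enq e t') p' = PState.enq e' u) :
    (p' = p ∧ e' = e ∧ u = t') ∨ (p' ≠ p ∧ e' ≠ e ∧ G.procs p' = PState.enq e' u) := by
  have := hG.owner_inj p' p e' u t
  simp only [Function.update_apply] at h
  grind

theorem procs_eq_of_update_deq {G : Ghost n} {p : Fin n} {e : ℕ} {t' : EnqState} {p' : Fin n}
    {u : DeqState} (h : Function.update G.procs p (PState.enq e t') p' = PState.deq u) :
    G.procs p' = PState.deq u := by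
  simp only [Function.update_apply] at h
  grind

theorem exists_owner_update {G : Ghost n} {p : Fin n} {e : ℕ} {t t' : EnqState}
    (hp : G.procs p = PState.enq e t) {e' : ℕ} (h : ∃ p' u, G.procs p' = PState.enq e' u) :
    ∃ p' u, Function.update G.procs p (PState.enq e t') p' = PState.enq e' u := by
  obtain ⟨p', u, h⟩ := h
  by_cases hpp : p' = p
  · subst hpp
    obtain ⟨rfl, -⟩ : e = e' ∧ t = u := by simpa [hp] using h
    exact ⟨p', t', by simp⟩
  · exact ⟨p', u, by simpa [hpp] using h⟩

/-- The new index `X` exceeds all indices handed out so far and is at least the bound `l` of every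
running scan. Hence indices stay distinct, grow along `hb`, and no scan has to know anything new. -/
theorem inv_getSlot {G : Ghost n} (hG : G.Inv) {p : Fin n} {e v : ℕ}
    (hp : G.procs p = PState.enq e (EnqState.E1 v)) : (G.getSlot p e v).Inv := by
  obtain ⟨hs, hv, hw⟩ := hG.enqInv _ _ _ hp
  have hX := hG.one_le_X
  have hne : ∀ x, 1 ≤ G.slot x → x ≠ e := by rintro x h rfl; omega
  have hslot : ∀ x, (G.getSlot p e v).slot x = if x = e then G.shared.X else G.slot x :=
    fun x => Function.update_apply ..
  exact { hG with
    one_le_X := Nat.le_succ_of_le hX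
    enq_lt := fun p' e' t h => by
      rcases procs_eq_of_update_enq hG hp h with ⟨-, rfl, -⟩ | ⟨-, -, h⟩
      · exact hG.enq_lt _ _ _ hp
      · exact hG.enq_lt _ _ _ h
    enq_not_returned := fun p' e' t h => by
      rcases procs_eq_of_update_enq hG hp h with ⟨-, rfl, -⟩ | ⟨-, -, h⟩
      · exact hG.enq_not_returned _ _ _ hp
      · exact hG.enq_not_returned _ _ _ h
    owner_inj := fun p' p'' e' t t' h h' => by
      have := hG.owner_inj p' p'' e' t t'
      rcases procs_eq_of_update_enq hG hp h with h | h <;>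
        rcases procs_eq_of_update_enq hG hp h' with h' | h' <;> grind
    exists_owner := fun e' h h' => exists_owner_update hp (hG.exists_owner e' h h')
    enqInv := fun p' e' t h => by
      rcases procs_eq_of_update_enq hG hp h with ⟨-, rfl, rfl⟩ | ⟨-, h1, h⟩
      · exact ⟨by simp [getSlot], hX, hv, hw⟩
      · have := hG.enqInv p' e' t h
        cases t <;> simpa [EnqInv, getSlot, h1] using this
    deqInv := fun p' t h => by
      have := hG.deqInv p' t (procs_eq_of_update_deq h)
      cases t with
      | D2 l => exact ⟨this.1, Nat.le_succ_of_le this.2⟩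
      | D3 l j =>
        refine ⟨this.1, Nat.le_succ_of_le this.2.1, fun e₁ e₂ h1 h2 h3 h4 h5 h6 => ?_⟩
        have h7 := this.1
        have h8 := this.2.1
        rw [hslot] at h1 h2 h4 h5
        -- If `e₁` or `e₂` is the operation that obtains its index, that index `X ≥ l > j` violates
        -- `h2` or `h5`.
        split_ifs at h1 h2 h4 h5 <;> first | omega | exact this.2.2 e₁ e₂ h1 h2 h3 h4 h5 h6
      | _ => exact this
    slot_of_written := fun x h => by
      have := hG.slot_of_written x h
      rw [hslot]; split_ifs <;> omega
    lt_of_slot := fun x h => by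
      rw [hslot] at h
      split_ifs at h with hx
      · rw [hx]; exact hG.enq_lt _ _ _ hp
      · exact hG.lt_of_slot x h
    slot_lt_X := fun x => by
      have := hG.slot_lt_X x
      change _ < G.shared.X + 1
      rw [hslot]; split_ifs <;> omega
    slot_inj := fun x y h h' => by
      have h1 := hG.slot_lt_X x
      have h2 := hG.slot_lt_X y
      rw [hslot] at h
      rw [hslot, hslot] at h'
      split_ifs at h h' with hx hy hy
      · rw [hx, hy]
      · omega
      · omega
      · exact hG.slot_inj x y h h'
    slot_lt_of_hb := fun x y h h' => by
      -- Having returned, `x` already holds an index, so it is not the operation that obtains one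
      -- now.
      have h1 := hG.slot_of_written x (hG.written_of_returned x (hG.returned_of_hb x y h))
      have h2 := hG.slot_lt_X x
      rw [hslot] at h'
      rw [hslot, hslot, if_neg (hne x h1)]
      split_ifs at h' ⊢
      · exact h2
      · exact hG.slot_lt_of_hb x y h h'
    read := fun x h h' => by
      rw [hslot, if_neg (hne x (hG.slot_of_written x h))]
      exact hG.read x h h'
    exists_of_read := fun j u h => by
      obtain ⟨x, h1, h2, h3, h4⟩ := hG.exists_of_read j u h
      exact ⟨x, h1, h2, by rwa [hslot, if_neg (hne x (hG.slot_of_written x h1))], h4⟩ }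

theorem inv_write {G : Ghost n} (hG : G.Inv) {p : Fin n} {e v i : ℕ}
    (hp : G.procs p = PState.enq e (EnqState.E2 v i)) : (G.write p e v i).Inv := by
  obtain ⟨hs, hi, hv, hw⟩ := hG.enqInv _ _ _ hp
  have hwr : ∀ x, (G.write p e v i).written x ↔ x = e ∨ G.written x := fun _ => Iff.rfl
  have hQ : ∀ j, (G.write p e v i).shared.Q j = if j = i then some v else G.shared.Q j :=
    fun x => Function.update_apply ..
  exact { hG with
    enq_lt := fun p' e' t h => by
      rcases procs_eq_of_update_enq hG hp h with ⟨-, rfl, -⟩ | ⟨-, -, h⟩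
      · exact hG.enq_lt _ _ _ hp
      · exact hG.enq_lt _ _ _ h
    enq_not_returned := fun p' e' t h => by
      rcases procs_eq_of_update_enq hG hp h with ⟨-, rfl, -⟩ | ⟨-, -, h⟩
      · exact hG.enq_not_returned _ _ _ hp
      · exact hG.enq_not_returned _ _ _ h
    owner_inj := fun p' p'' e' t t' h h' => by
      have := hG.owner_inj p' p'' e' t t'
      rcases procs_eq_of_update_enq hG hp h with h | h <;>
        rcases procs_eq_of_update_enq hG hp h' with h' | h' <;> grind
    exists_owner := fun e' h h' => exists_owner_update hp (hG.exists_owner e' h h')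
    enqInv := fun p' e' t h => by
      rcases procs_eq_of_update_enq hG hp h with ⟨-, rfl, rfl⟩ | ⟨-, h1, h⟩
      · exact Or.inl rfl
      · have := hG.enqInv p' e' t h
        cases t <;> simpa [EnqInv, write, h1] using this
    deqInv := fun p' t h => by
      have := hG.deqInv p' t (procs_eq_of_update_deq h)
      cases t <;> exact this
    written_of_returned := fun x h => Or.inr (hG.written_of_returned x h)
    written_of_taken := fun x h => Or.inr (hG.written_of_taken x h)
    slot_of_written := fun x h => h.elim
      (fun h => by rw [h]; exact hi.trans_eq hs.symm) (hG.slot_of_written x)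
    read := fun x h h' => by
      rw [hQ]
      rcases (hwr x).1 h with rfl | h
      · exact (if_pos hs).trans (congrArg some hv.symm)
      · rw [if_neg]
        · exact hG.read x h h'
        -- Indices are distinct, so the write cannot hit the cell of another written operation.
        · intro hx
          have := hG.slot_inj x e (hG.slot_of_written x h) (hx.trans hs.symm)
          exact hw (this ▸ h)
    exists_of_read := fun j u h => by
      rw [hQ] at h
      split_ifs at h with hj
      · refine ⟨e, Or.inl rfl, fun h => hw (hG.written_of_taken e h), hs.trans hj.symm, ?_⟩
        exact hv.trans (by simpa using h)
      · obtain ⟨x, h1, h2, h3, h4⟩ := hG.exists_of_read j u h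
        exact ⟨x, Or.inr h1, h2, h3, h4⟩ }

theorem inv_retEnq {G : Ghost n} (hG : G.Inv) {p : Fin n} {e : ℕ}
    (hp : G.procs p = PState.enq e EnqState.E3) : (G.retEnq p e).Inv := by
  have hw : G.written e := hG.enqInv _ _ _ hp
  have hq : ∀ p' e' t, (G.retEnq p e).procs p' = PState.enq e' t →
      e' ≠ e ∧ G.procs p' = PState.enq e' t := by
    intro p' e' t
    have := hG.owner_inj p' p e' t EnqState.E3
    simp only [retEnq, Function.update_apply]
    grind
  exact { hG with
    enq_lt := fun p' e' t h => hG.enq_lt p' e' t (hq _ _ _ h).2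
    enq_not_returned := fun p' e' t h h' =>
      h'.elim (hq _ _ _ h).1 (hG.enq_not_returned p' e' t (hq _ _ _ h).2)
    owner_inj := fun p' p'' e' t t' h h' =>
      hG.owner_inj p' p'' e' t t' (hq _ _ _ h).2 (hq _ _ _ h').2
    exists_owner := fun e' h h' => by
      obtain ⟨p', t, hp'⟩ := hG.exists_owner e' h fun hc => h' (Or.inr hc)
      have hne : p' ≠ p := by
        rintro rfl
        rw [hp] at hp'
        simp only [PState.enq.injEq] at hp'
        exact h' (Or.inl hp'.1.symm)
      exact ⟨p', t, by simpa [retEnq, hne] using hp'⟩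
    enqInv := fun p' e' t h => by
      have := hG.enqInv p' e' t (hq _ _ _ h).2
      cases t <;> exact this
    deqInv := fun p' t h => by
      have h' : G.procs p' = PState.deq t := by
        simp only [retEnq, Function.update_apply] at h
        grind
      have := hG.deqInv p' t h'
      cases t <;> exact this
    written_of_returned := fun x h => h.elim (fun h => h ▸ hw) (hG.written_of_returned x)
    returned_of_hb := fun x y h => Or.inr (hG.returned_of_hb x y h) }

/-- Enlarging `taken` only weakens what the other scans must know, and by distinctness of indices
the cleared cell belongs to `e` alone. -/
theorem inv_take {G : Ghost n} (hG : G.Inv) {p : Fin n} {l j e : ℕ}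
    (hp : G.procs p = PState.deq (DeqState.D3 l j)) (hw : G.written e)
    (hj : G.slot e = j) (x : ℕ) : (G.take p e j x).Inv := by
  have hq : ∀ p' e' t, (G.take p e j x).procs p' = PState.enq e' t ↔
      G.procs p' = PState.enq e' t := by
    intro p' e' t
    simp only [take, Function.update_apply]
    grind
  have hQ : ∀ i, (G.take p e j x).shared.Q i = if i = j then none else G.shared.Q i :=
    fun x => Function.update_apply ..
  exact { hG with
    enq_lt := fun p' e t h => hG.enq_lt p' e t ((hq _ _ _).1 h)
    enq_not_returned := fun p' e t h => hG.enq_not_returned p' e t ((hq _ _ _).1 h)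
    owner_inj := fun p' p'' e t t' h h' =>
      hG.owner_inj p' p'' e t t' ((hq _ _ _).1 h) ((hq _ _ _).1 h')
    exists_owner := fun e h h' => by simpa only [hq] using hG.exists_owner e h h'
    enqInv := fun p' e' t h => by
      have := hG.enqInv p' e' t ((hq _ _ _).1 h)
      cases t <;> exact this
    deqInv := fun p' t h => by
      simp only [take, Function.update_apply] at h
      split_ifs at h with h'
      · obtain rfl := PState.deq.inj h
        trivial
      · have := hG.deqInv p' t h
        cases t with
        | D3 l' j' =>
          exact ⟨this.1, this.2.1, fun e₁ e₂ h1 h2 h3 h4 h5 =>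
            this.2.2 e₁ e₂ h1 h2 (fun h => h3 (Or.inr h)) h4 h5⟩
        | _ => exact this
    written_of_taken := fun y h => h.elim (fun h => h ▸ hw) (hG.written_of_taken y)
    read := fun y h h' => by
      rw [hQ, if_neg]
      · exact hG.read y h fun h => h' (Or.inr h)
      · intro hy
        exact h' (Or.inl (hG.slot_inj y e (hG.slot_of_written y h) (hy.trans hj.symm)))
    exists_of_read := fun i u h => by
      rw [hQ] at h
      split_ifs at h with hi
      obtain ⟨y, h1, h2, h3, h4⟩ := hG.exists_of_read i u h
      refine ⟨y, h1, fun h => h.elim ?_ h2, h3, h4⟩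
      rintro rfl
      exact hi (h3.symm.trans hj) }

end Ghost

end HWQ

/-! ### The backward simulation by the sequential queue -/

namespace HWQ

/-- The sequential queue. -/
def queueLTS : LTS (Operation queueInterface) where
  State := List ℕ
  init := []
  Tr := QueueTr

namespace Ghost

variable {n : ℕ}

/-- `q` is a possible content of the abstract queue: the enqueue operations that have taken
effect and whose values have not been removed, in an order that respects the real-time order. -/
structure Represents (G : Ghost n) (q : List ℕ) : Prop where
  nodup : q.Nodup
  lt_size : ∀ e ∈ q, e < G.size
  not_taken : ∀ e ∈ q, ¬ G.taken e
  mem : ∀ e, G.returned e → ¬ G.taken e → e ∈ q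
  pairwise : q.Pairwise (fun a b => ¬ G.hb b a)

open Classical in
/-- The status of a process as a user of the abstract queue with content `q`. -/
noncomputable def statusOf (val : ℕ → ℕ) (took : ℕ → Prop) : PState → Status queueInterface
  | PState.idle => Status.idle
  | PState.enq e _ =>
    if took e then Status.done (enqOp (val e)) else Status.called QMethod.enq (val e)
  | PState.deq (DeqState.D4 x) => Status.done (deqOp (some x))
  | PState.deq _ => Status.called QMethod.deq ()

theorem statusOf_congr {val val' : ℕ → ℕ} {took took' : ℕ → Prop} {s : PState}
    (h : ∀ e t, s = PState.enq e t → val e = val' e ∧ (took e ↔ took' e)) :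
    statusOf val took s = statusOf val' took' s := by
  cases s with
  | idle => rfl
  | enq e t =>
    obtain ⟨h1, h2⟩ := h e t rfl
    by_cases h3 : took e
    · simp [statusOf, h1, h3, h2.1 h3]
    · simp [statusOf, h1, h3, mt h2.2 h3]
  | deq t => cases t <;> rfl

/-- The status of the processes when the abstract queue has content `q`. -/
noncomputable def status (G : Ghost n) (q : List ℕ) (p : Fin n) : Status queueInterface :=
  statusOf G.val (fun e => e ∈ q ∨ G.taken e) (G.procs p)

/-- Runs of the abstract queue that lead to the content `q`. -/
def Run (G : Ghost n) (q : List ℕ) (h : List (Action queueInterface n))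
    (w : List (Fin n × Operation queueInterface)) : Prop :=
  AtomicRun queueLTS h w (G.status q) (q.map G.val)

theorem Run.congr {G G' : Ghost n} {q q' : List ℕ} {h : List (Action queueInterface n)}
    {w : List (Fin n × Operation queueInterface)} (hr : G.Run q h w)
    (hs : ∀ p, G'.status q' p = G.status q p) (hq : q'.map G'.val = q.map G.val) :
    G'.Run q' h w := by
  unfold Run
  rw [hq, funext hs]
  exact hr

/-- The abstract queue can follow the step from `G` to `G'` with the visible actions `t`. -/
def Follows (G G' : Ghost n) (t : List (Action queueInterface n)) : Prop :=
  ∀ q', G'.Represents q' → ∃ q, G.Represents q ∧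
    ∀ h w, G.Run q h w → ∃ w', G'.Run q' (h ++ t) w'

theorem Represents.setProc_iff {G : Ghost n} {p : Fin n} {s : PState} {q : List ℕ} :
    (G.setProc p s).Represents q ↔ G.Represents q :=
  ⟨fun h => ⟨h.nodup, h.lt_size, h.not_taken, h.mem, h.pairwise⟩,
    fun h => ⟨h.nodup, h.lt_size, h.not_taken, h.mem, h.pairwise⟩⟩

theorem status_setProc (G : Ghost n) (p : Fin n) (s : PState) (q : List ℕ) :
    (G.setProc p s).status q = Function.update (G.status q) p
      (statusOf G.val (fun e => e ∈ q ∨ G.taken e) s) := by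
  funext p'
  simp only [status, setProc, Function.update_apply]
  split_ifs <;> rfl

theorem follows_setProc {G : Ghost n} {p : Fin n} {s : PState}
    (hs : ∀ took, statusOf G.val took s = statusOf G.val took (G.procs p)) :
    G.Follows (G.setProc p s) [] := by
  intro q hq
  refine ⟨q, Represents.setProc_iff.1 hq, fun h w hr => ⟨w, ?_⟩⟩
  rw [List.append_nil]
  refine hr.congr (fun p' => ?_) rfl
  rw [status_setProc, hs]
  exact congrFun (Function.update_eq_self p (G.status q)) p'

theorem follows_callDeq {G : Ghost n} {p : Fin n} (hp : G.procs p = PState.idle) :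
    G.Follows (G.setProc p (PState.deq DeqState.D1)) [Action.call p QMethod.deq ()] := by
  intro q hq
  refine ⟨q, Represents.setProc_iff.1 hq, fun h w hr => ⟨w, ?_⟩⟩
  unfold Run
  rw [status_setProc]
  exact AtomicRun.call p QMethod.deq () hr (by simp [status, hp, statusOf])

theorem follows_retDeq {G : Ghost n} {p : Fin n} {x : ℕ}
    (hp : G.procs p = PState.deq (DeqState.D4 x)) :
    G.Follows (G.setProc p PState.idle) [Action.ret p QMethod.deq (some x)] := by
  intro q hq
  refine ⟨q, Represents.setProc_iff.1 hq, fun h w hr => ⟨w, ?_⟩⟩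
  unfold Run
  rw [status_setProc]
  exact AtomicRun.ret p (deqOp (some x)) hr (by simp [status, hp, statusOf])

/-- Neither `Represents` nor `Run` looks at the memory or at slots, so for the abstract queue this
is definitionally a change of local state with equal status. The same holds for the write, as
`written` does not occur there either. -/
theorem follows_getSlot {G : Ghost n} {p : Fin n} {e v : ℕ}
    (hp : G.procs p = PState.enq e (EnqState.E1 v)) : G.Follows (G.getSlot p e v) [] := by
  intro q hq
  exact follows_setProc (G := G) (p := p) (s := PState.enq e (EnqState.E2 v G.shared.X))
    (by simp [hp, statusOf]) q ⟨hq.nodup, hq.lt_size, hq.not_taken, hq.mem, hq.pairwise⟩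

theorem follows_write {G : Ghost n} {p : Fin n} {e v i : ℕ}
    (hp : G.procs p = PState.enq e (EnqState.E2 v i)) : G.Follows (G.write p e v i) [] := by
  intro q hq
  exact follows_setProc (G := G) (p := p) (s := PState.enq e EnqState.E3)
    (by simp [hp, statusOf]) q ⟨hq.nodup, hq.lt_size, hq.not_taken, hq.mem, hq.pairwise⟩

theorem follows_retEnq {G : Ghost n} {p : Fin n} {e : ℕ} {s : EnqState}
    (hp : G.procs p = PState.enq e s) :
    G.Follows (G.retEnq p e) [Action.ret p QMethod.enq ()] := by
  intro q hq
  refine ⟨q, ⟨hq.nodup, hq.lt_size, hq.not_taken, fun x hx => hq.mem x (Or.inr hx),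
    hq.pairwise⟩, fun h w hr => ⟨w, ?_⟩⟩
  -- After the step `e` counts as returned, so an admissible content contains it unless it is taken.
  -- In both cases it took effect earlier.
  have he : e ∈ q ∨ G.taken e := or_iff_not_imp_right.2 (hq.mem e (Or.inl rfl))
  have := AtomicRun.ret p (enqOp (G.val e)) hr (by simp [status, hp, statusOf, he])
  have hs : (G.retEnq p e).status q = Function.update (G.status q) p Status.idle :=
    status_setProc G p PState.idle q
  unfold Run
  rw [hs]
  exact this

/-- The content before the swap is `e :: q`, and the dequeue takes effect here. Any `y` with `hb y
e` has an index below `j`; the scan has passed it, so by `DeqInv` such a `y` cannot be untaken. -/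
theorem follows_take {G : Ghost n} (hG : G.Inv) {p : Fin n} {l j e : ℕ}
    (hp : G.procs p = PState.deq (DeqState.D3 l j)) (hw : G.written e) (ht : ¬ G.taken e)
    (hj : G.slot e = j) : G.Follows (G.take p e j (G.val e)) [] := by
  intro q hq
  have hd := hG.deqInv p _ hp
  have hq' : ∀ y ∈ q, y ≠ e ∧ ¬ G.taken y := fun y hy =>
    ⟨fun h => hq.not_taken y hy (Or.inl h), fun h => hq.not_taken y hy (Or.inr h)⟩
  have hhb : ∀ y, ¬ G.taken y → ¬ G.hb y e := by
    intro y hy hb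
    have h1 := hG.slot_of_written e hw
    have h2 := hG.slot_lt_of_hb y e hb h1
    have h3 := hG.slot_of_written y (hG.written_of_returned y (hG.returned_of_hb y e hb))
    exact hd.2.2 y e h3 (hj ▸ h2) hy h1 (hj ▸ hd.1) hb
  refine ⟨e :: q, ⟨?_, ?_, ?_, ?_, ?_⟩, fun h w hr => ?_⟩
  · exact List.nodup_cons.2 ⟨fun h => (hq' e h).1 rfl, hq.nodup⟩
  · exact List.forall_mem_cons.2 ⟨hG.lt_of_slot e (hG.slot_of_written e hw), hq.lt_size⟩
  · exact List.forall_mem_cons.2 ⟨ht, fun y hy => (hq' y hy).2⟩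
  · intro y hy hty
    by_cases hye : y = e
    · simp [hye]
    · exact List.mem_cons_of_mem _ (hq.mem y hy fun h => h.elim hye hty)
  · exact List.pairwise_cons.2 ⟨fun y hy => hhb y (hq' y hy).2, hq.pairwise⟩
  · have hst : G.status (e :: q) p = Status.called QMethod.deq () := by
      simp [status, hp, statusOf]
    have := AtomicRun.lin p (deqOp (some (G.val e))) hr hst
      (QueueTr.deq (q.map G.val) (G.val e))
    refine ⟨w ++ [(p, deqOp (some (G.val e)))], ?_⟩
    have hs : (G.take p e j (G.val e)).status q =
        Function.update (G.status (e :: q)) p (Status.done (deqOp (some (G.val e)))) := by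
      funext p'
      -- Since `e` moves from the content to the taken operations, the status of its enqueuer does
      -- not change.
      have hm : ∀ y, (y ∈ q ∨ (G.take p e j (G.val e)).taken y) ↔ (y ∈ e :: q ∨ G.taken y) := by
        intro y
        simp only [take, List.mem_cons]
        tauto
      simp only [status, hm]
      simp only [take, Function.update_apply]
      split_ifs <;> rfl
    unfold Run
    rw [hs, List.append_nil]
    exact this

/-- Pending enqueue operations can take effect at any time. -/
theorem Run.exists_append {G : Ghost n} (hG : G.Inv) {h : List (Action queueInterface n)} :
    ∀ (q₂ : List ℕ) {q₁ : List ℕ} {w : List (Fin n × Operation queueInterface)},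
      G.Run q₁ h w → (q₁ ++ q₂).Nodup →
      (∀ e ∈ q₂, e < G.size ∧ ¬ G.returned e ∧ ¬ G.taken e) → ∃ w', G.Run (q₁ ++ q₂) h w' := by
  intro q₂
  induction q₂ with
  | nil => intro q₁ w hr _ _; exact ⟨w, by simpa using hr⟩
  | cons e q₂ ih =>
    intro q₁ w hr hnd hq
    obtain ⟨⟨hlt, hret, ht⟩, hq₂⟩ := List.forall_mem_cons.1 hq
    obtain ⟨p, s, hp⟩ := hG.exists_owner e hlt hret
    have he : e ∉ q₁ := fun h => (List.disjoint_of_nodup_append hnd) h (List.mem_cons_self ..)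
    have hst : G.status q₁ p = Status.called QMethod.enq (G.val e) := by
      simp [status, hp, statusOf, he, ht]
    have hrun := AtomicRun.lin p (enqOp (G.val e)) hr hst (QueueTr.enq (q₁.map G.val) (G.val e))
    have hs : G.status (q₁ ++ [e]) =
        Function.update (G.status q₁) p (Status.done (enqOp (G.val e))) := by
      funext p'
      by_cases hpp : p' = p
      · subst hpp; simp [status, hp, statusOf]
      · rw [Function.update_of_ne hpp]
        refine statusOf_congr fun e' s' hp' => ⟨rfl, ?_⟩
        have : e' ≠ e := by
          rintro rfl
          exact hpp (hG.owner_inj _ _ _ _ _ hp' hp)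
        simp [this]
    have hrun' : G.Run (q₁ ++ [e]) h (w ++ [(p, enqOp (G.val e))]) := by
      unfold Run
      rw [hs, List.map_append]
      exact hrun
    simpa using ih hrun' (by simpa using hnd) hq₂

theorem run_callEnq {G : Ghost n} (hG : G.Inv) {p : Fin n} {v : ℕ}
    (hp : G.procs p = PState.idle) {q : List ℕ} (hq : ∀ e ∈ q, e < G.size)
    {h : List (Action queueInterface n)} {w : List (Fin n × Operation queueInterface)}
    (hr : G.Run q h w) :
    (G.callEnq p v).Run q (h ++ [Action.call p QMethod.enq v]) w := by
  have hs : (G.callEnq p v).status q =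
      Function.update (G.status q) p (Status.called QMethod.enq v) := by
    funext p'
    by_cases hpp : p' = p
    · subst hpp
      have h1 : G.size ∉ q := fun h => (hq _ h).false
      have h2 : ¬ G.taken G.size := fun h =>
        (hG.lt_of_slot _ (hG.slot_of_written _ (hG.written_of_taken _ h))).false
      simp [status, callEnq, statusOf, h1, h2]
    · rw [Function.update_of_ne hpp]
      simp only [status, callEnq, Function.update_of_ne hpp]
      refine statusOf_congr fun e' s' hp' => ⟨?_, Iff.rfl⟩
      simp [(hG.enq_lt _ _ _ hp').ne]
  have hv : q.map (G.callEnq p v).val = q.map G.val :=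
    List.map_congr_left fun e he => by simp [callEnq, (hq e he).ne]
  unfold Run
  rw [hs, hv]
  exact AtomicRun.call p QMethod.enq v hr (by simp [status, hp, statusOf])

/-- The identifier `G.size` does not exist before the call, so a content that contains it must be
cut there. All returned operations are `hb`-before the new one and cannot stand behind it; the tail
`q₂` thus consists of pending enqueues, which take effect in this order right after the call. -/
theorem follows_callEnq {G : Ghost n} (hG : G.Inv) {p : Fin n} {v : ℕ}
    (hp : G.procs p = PState.idle) :
    G.Follows (G.callEnq p v) [Action.call p QMethod.enq v] := by
  intro q hq
  have hG' := inv_callEnq hG (v := v) hp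
  obtain ⟨q₁, q₂, rfl, h₁, h₂⟩ : ∃ q₁ q₂, q = q₁ ++ q₂ ∧ G.size ∉ q₁ ∧
      ∀ e ∈ q₂, ¬ G.returned e := by
    by_cases hm : G.size ∈ q
    · obtain ⟨q₁, q₂, rfl⟩ := List.append_of_mem hm
      refine ⟨q₁, G.size :: q₂, rfl, ?_, List.forall_mem_cons.2 ⟨?_, ?_⟩⟩
      · exact fun h => List.disjoint_of_nodup_append hq.nodup h (List.mem_cons_self ..)
      · exact hG'.enq_not_returned p G.size (EnqState.E1 v) (by simp [callEnq])
      · intro e he hr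
        have := (List.pairwise_append.1 hq.pairwise).2.1
        exact List.rel_of_pairwise_cons this he (Or.inr ⟨hr, rfl⟩)
    · exact ⟨q, [], by simp, hm, by simp⟩
  have hlt : ∀ e ∈ q₁, e < G.size := fun e he =>
    lt_of_le_of_ne (Nat.le_of_lt_succ (hq.lt_size e (List.mem_append_left _ he)))
      (fun h => h₁ (h ▸ he))
  refine ⟨q₁, ⟨hq.nodup.of_append_left, hlt,
    fun e he => hq.not_taken e (List.mem_append_left _ he), ?_, ?_⟩, fun h w hr => ?_⟩
  · exact fun e he ht => (List.mem_append.1 (hq.mem e he ht)).resolve_right fun h => h₂ e h he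
  · exact (List.pairwise_append.1 hq.pairwise).1.imp fun h h' => h (Or.inl h')
  · exact (run_callEnq hG hp hlt hr).exists_append hG' q₂ hq.nodup fun e he =>
      ⟨hq.lt_size e (List.mem_append_right _ he), h₂ e he,
        hq.not_taken e (List.mem_append_right _ he)⟩

-- The order of calls serves as a witness, because `hb x y` implies `x < y`. This starts the
-- backward choice at the end of a trace.
open Classical in
theorem Inv.exists_represents {G : Ghost n} (hG : G.Inv) : ∃ q, G.Represents q := by
  refine ⟨(List.range G.size).filter (fun e => G.returned e ∧ ¬ G.taken e),
    List.nodup_range.filter _, ?_, ?_, ?_, ?_⟩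
  · intro e he
    simpa using (List.mem_filter.1 he).1
  · intro e he
    have := (List.mem_filter.1 he).2
    simp only [decide_eq_true_eq] at this
    exact this.2
  · intro e h1 h2
    have := hG.lt_of_slot e (hG.slot_of_written e (hG.written_of_returned e h1))
    simp [h1, h2, this]
  · exact (List.pairwise_lt_range.imp fun h h' => (h.trans (hG.lt_of_hb _ _ h')).false).filter _

/-! ### From single steps to whole traces -/

/-- The ghost variables describe the configuration `c`. -/
def Describes (G : Ghost n) (c : hwq.Config n) : Prop :=
  c.shared = G.shared ∧ ∀ p, c.procs p = (G.procs p).toLocal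

theorem exists_follows {G : Ghost n} (hG : G.Inv) {c c' : hwq.Config n} (hc : G.Describes c)
    {b : Label queueInterface n} (ht : hwq.Tr n c b c') :
    ∃ G' : Ghost n, G'.Inv ∧ G'.Describes c' ∧ G.Follows G' (history [b]) := by
  obtain ⟨hcs, hcp⟩ := hc
  have hidle : ∀ {p}, c.procs p = none → G.procs p = PState.idle := by
    intro p h
    rw [hcp] at h
    cases hp : G.procs p <;> simp_all [PState.toLocal]
  have henq : ∀ {p} {s : EnqState}, c.procs p = some ⟨QMethod.enq, s⟩ →
      ∃ e, G.procs p = PState.enq e s := by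
    intro p s h
    rw [hcp] at h
    cases hp : G.procs p with
    | enq e s' =>
      rw [hp] at h
      simp only [PState.toLocal, Option.some.injEq] at h
      cases h
      exact ⟨e, rfl⟩
    | deq s' =>
      rw [hp] at h
      simp only [PState.toLocal, Option.some.injEq] at h
      cases h
    | idle => simp [hp, PState.toLocal] at h
  have hdeq : ∀ {p} {s : DeqState}, c.procs p = some ⟨QMethod.deq, s⟩ →
      G.procs p = PState.deq s := by
    intro p s h
    rw [hcp] at h
    cases hp : G.procs p with
    | deq s' =>
      rw [hp] at h
      simp only [PState.toLocal, Option.some.injEq] at h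
      cases h
      rfl
    | enq e s' =>
      rw [hp] at h
      simp only [PState.toLocal, Option.some.injEq] at h
      cases h
    | idle => simp [hp, PState.toLocal] at h
  have hupd : ∀ (p : Fin n) (s : PState) (p' : Fin n),
      Function.update c.procs p s.toLocal p' = (Function.update G.procs p s p').toLocal := by
    intro p s p'
    by_cases h : p' = p
    · subst h; simp
    · simp [h, hcp]
  cases ht with
  | call p m a hp =>
    cases m with
    | enq =>
      exact ⟨G.callEnq p a, inv_callEnq hG (hidle hp),
        ⟨hcs, hupd p (PState.enq G.size (EnqState.E1 a))⟩, follows_callEnq hG (hidle hp)⟩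
    | deq =>
      refine ⟨G.setProc p (PState.deq DeqState.D1), inv_setProc hG (by simp [hidle hp]) (by simp) ?_,
        ⟨hcs, hupd p (PState.deq DeqState.D1)⟩, follows_callDeq (hidle hp)⟩
      rintro t ht
      obtain rfl := PState.deq.inj ht
      trivial
  | step p m l l' g hp hs =>
    cases m with
    | enq =>
      obtain ⟨e, hp⟩ := henq hp
      rw [hcs] at hs
      change EnqStep _ _ _ _ at hs
      cases hs with
      | E1 v => exact ⟨G.getSlot p e v, inv_getSlot hG hp, ⟨rfl, hupd p (PState.enq e _)⟩,
          follows_getSlot hp⟩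
      | E2 v i => exact ⟨G.write p e v i, inv_write hG hp, ⟨rfl, hupd p (PState.enq e _)⟩,
          follows_write hp⟩
    | deq =>
      replace hp := hdeq hp
      rw [hcs] at hs
      change DeqStep _ _ _ _ at hs
      have hinv := hG.deqInv _ _ hp
      have silent : ∀ {s : DeqState}, G.DeqInv s →
          (∀ took, statusOf G.val took (PState.deq s) = statusOf G.val took (G.procs p)) →
          ∃ G' : Ghost n, G'.Inv ∧
            G'.Describes ⟨G.shared, Function.update c.procs p (some ⟨QMethod.deq, s⟩)⟩ ∧
            G.Follows G' (history [Label.internal p]) := by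
        intro s hd hst
        refine ⟨G.setProc p (PState.deq s), inv_setProc hG (by simp [hp]) (by simp) ?_,
          ⟨rfl, hupd p (PState.deq s)⟩, follows_setProc hst⟩
        intro t ht
        obtain rfl := PState.deq.inj ht
        exact hd
      cases hs with
      | D1 => exact silent ⟨hG.one_le_X, le_rfl⟩ (by simp [hp, statusOf])
      | D2_retry => exact silent trivial (by simp [hp, statusOf])
      | D2_scan l hl =>
        refine silent ⟨?_, hinv.2, fun e₁ e₂ h1 h2 => ?_⟩ (by simp [hp, statusOf])
        -- A scan starting at `j = 1` has passed no index, so only `1 < l` needs the test in `D2`.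
        · have := hinv.1
          omega
        · omega
      | D3_take l j x hx =>
        obtain ⟨e, hw, ht, hj, rfl⟩ := hG.exists_of_read j x hx
        exact ⟨G.take p e j (G.val e), inv_take hG hp hw hj _,
          ⟨rfl, hupd p (PState.deq (DeqState.D4 _))⟩, follows_take hG hp hw ht hj⟩
      | D3_retry l j => exact silent trivial (by simp [hp, statusOf])
      | D3_next l j hn hl =>
        refine silent ⟨?_, hinv.2.1, fun e₁ e₂ h1 h2 h3 h4 h5 h6 => ?_⟩ (by simp [hp, statusOf])
        · have := hinv.1
          omega
        · rcases Nat.lt_succ_iff_lt_or_eq.1 h2 with h2 | h2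
          · exact hinv.2.2 e₁ e₂ h1 h2 h3 h4 h5 h6
          -- The cell `j` was found empty. Were `hb e₁ e₂` true, `e₁` would have returned and hence
          -- written its value there; being untaken, the value would still be there.
          · have := hG.read e₁ (hG.written_of_returned _ (hG.returned_of_hb _ _ h6)) h3
            rw [h2, hn] at this
            simp at this
  | ret p m l b hp ho =>
    cases m with
    | enq =>
      obtain ⟨rfl, rfl⟩ : l = EnqState.E3 ∧ b = () := ho
      obtain ⟨e, hp⟩ := henq hp
      exact ⟨G.retEnq p e, inv_retEnq hG hp, ⟨hcs, hupd p PState.idle⟩, follows_retEnq hp⟩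
    | deq =>
      obtain ⟨x, rfl, rfl⟩ : ∃ x, l = DeqState.D4 x ∧ b = some x := ho
      replace hp := hdeq hp
      exact ⟨G.setProc p PState.idle, inv_setProc hG (by simp [hp]) (by simp) (by simp),
        ⟨hcs, hupd p PState.idle⟩, follows_retDeq hp⟩

/-- The content `q` depends on the future steps only and not on the run that reaches it, which
explains the order of the quantifiers: contents are chosen from the end of the path, runs are
extended from its beginning. -/
theorem exists_run {G : Ghost n} (hG : G.Inv) {c c' : (hwq.semantics n).State} (hc : G.Describes c)
    {t : List (Label queueInterface n)} (ht : (hwq.semantics n).Path c t c') :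
    ∃ q, G.Represents q ∧ ∀ h w, G.Run q h w →
      ∃ w' st q', AtomicRun queueLTS (h ++ history t) w' st q' := by
  induction ht generalizing G with
  | nil c =>
    obtain ⟨q, hq⟩ := hG.exists_represents
    exact ⟨q, hq, fun h w hr => ⟨w, _, _, by simpa [history, Run] using hr⟩⟩
  | @cons c c' c'' b t hb _ ih =>
    obtain ⟨G', hG', hc', hf⟩ := exists_follows hG hc hb
    obtain ⟨q', hq', hr'⟩ := ih hG' hc'
    obtain ⟨q, hq, hr⟩ := hf q' hq'
    refine ⟨q, hq, fun h w hw => ?_⟩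
    obtain ⟨w₁, hw₁⟩ := hr h w hw
    have := hr' _ _ hw₁
    rw [List.append_assoc] at this
    rwa [show history (b :: t) = history [b] ++ history t from
      List.filterMap_append (l := [b]) (l' := t)]

/-- The ghost variables in the initial configuration. -/
def initial (n : ℕ) : Ghost n where
  shared := { Q := fun _ => none, X := 1 }
  procs := fun _ => PState.idle
  size := 0
  val := fun _ => 0
  slot := fun _ => 0
  hb := fun _ _ => False
  written := fun _ => False
  taken := fun _ => False
  returned := fun _ => False

theorem inv_initial (n : ℕ) : (initial n).Inv := by
  constructor <;> simp [initial]

end Ghost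

end HWQ

theorem corollary1 (n : ℕ) : HWQ.hwq.Linearizable HWQ.queueSpec n := by
  rintro t ⟨c, hc⟩
  obtain ⟨q, hq, hr⟩ := HWQ.Ghost.exists_run (HWQ.Ghost.inv_initial n)
    (c := (HWQ.hwq.semantics n).init) ⟨rfl, fun _ => rfl⟩ hc
  -- No identifier exists initially, so the content chosen from the future is empty, and the empty
  -- run reaches it.
  obtain rfl : q = [] := List.eq_nil_iff_forall_not_mem.2 fun e he =>
    Nat.not_lt_zero e (hq.lt_size e he)
  obtain ⟨w, st, q', hw⟩ := hr [] [] HWQ.AtomicRun.init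
  exact hw.linearizableHistory
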